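/- Let $d\in\mathbb N$ and let $\mathcal S_{\rm even},\mathcal S_{\rm odd},V_{\rm even},V_{\rm odd}\subset\mathbb R^d$ with $V_{\rm even},V_{\rm odd}$ finite, such that $x+v\in\mathcal S_{\rm odd}$ for all $x\in\mathcal S_{\rm even}$, $v\in V_{\rm odd}$; $x+v\in\mathcal S_{\rm even}$ for all $x\in\mathcal S_{\rm odd}$, $v\in V_{\rm even}$; $V_{\rm odd}=-V_{\rm even}$; $0\in\mathcal S_{\rm even}$; and $V_{\rm odd}\cap V_{\rm even}=\emptyset$. Put $V=V_{\rm odd}\cup V_{\rm even}$ and $m=\sharp V_{\rm odd}=\sharp V_{\rm even}$, and assume $m\ge 2$. Let $p,q\in[0,1]$ and $$\alpha=\frac{mp-1}{m-1},\quad \beta=\frac{mq-1}{m-1},\quad \gamma=\frac{\alpha+\beta}{2},\quad \delta=\frac{\alpha-\beta}{2},\quad \bar v=\frac1m\sum_{v\in V_{\rm odd}}v .$$ The elephant random walk $(S_n)_{n\ge0}$ is defined as follows. The first step $X_1$ is uniformly distributed on $V_{\rm odd}$. For $n\ge1$, $X_{n+1}=G_{n+1}(X_{\mathcal U_n})$,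 where $\mathcal U_n$ is uniformly distributed on $\{1,\dots,n\}$ and, for $k\ge2$ and $v\in V$, the random variable $G_k(v)$ takes values in $V_k$, with $V_k:=V_{\rm odd}$ if $k$ is odd and $V_k:=V_{\rm even}$ if $k$ is even. Its law is as follows: if $v\in V_k$, then $G_k(v)$ equals $v$ with probability $p$ and each other element of $V_k$ with probability $\frac{1-p}{m-1}$; if $v\notin V_k$ (so that $-v\in V_k$), then $G_k(v)$ equals $-v$ with probability $q$ and each other element of $V_k$ with probability $\frac{1-q}{m-1}$. The $\sigma$-algebras $\sigma(X_1)$, $\sigma(\mathcal U_1,\{G_2(v)\}_{v\in V})$, $\sigma(\mathcal U_2,\{G_3(v)\}_{v\in V}),\dots$ are independent, and for every $n\ge1$ and $v\in V$ the variables $\mathcal U_n$ and $G_{n+1}(v)$ are independent. Finally $S_0=0$ and $S_{n+1}=S_n+X_{n+1}$. Assume that $\gamma<1$ and $\delta<1/2$. Then, as $n\to\infty$, $S_n/\sqrt n$ converges in distribution to the centered $d$-dimensional Gaussian distribution $\mathcal N_d(0,\Sigma)$ with the (positive semidefinite, possibly singular) covariance matrix $$\Sigma=\frac{1}{m(1-2\delta)}\sum_{v\in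 V_{\rm odd}}(v-\bar v)(v-\bar v)^\top .$$ -/

import Mathlib

open MeasureTheory ProbabilityTheory Filter

noncomputable section

/-- The abstract setting of the walk: state spaces `Seven`, `Sodd` and finite step sets
`Vodd`, `Veven` in `ℝ^d`.  Steps in `Vodd` lead from `Seven` to `Sodd`, steps in `Veven` lead from
`Sodd` to `Seven`, the two step sets are disjoint and negatives of each other, the origin lies in
`Seven`, and there are at least two admissible directions. -/
structure ERWSetting (d : ℕ) where
  Seven : Set (EuclideanSpace ℝ (Fin d))
  Sodd : Set (EuclideanSpace ℝ (Fin d))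
  Veven : Finset (EuclideanSpace ℝ (Fin d))
  Vodd : Finset (EuclideanSpace ℝ (Fin d))
  add_mem_Sodd : ∀ x ∈ Seven, ∀ v ∈ Vodd, x + v ∈ Sodd
  add_mem_Seven : ∀ x ∈ Sodd, ∀ v ∈ Veven, x + v ∈ Seven
  mem_Vodd_iff : ∀ v, v ∈ Vodd ↔ -v ∈ Veven
  zero_mem_Seven : 0 ∈ Seven
  disjoint_steps : Disjoint Vodd Veven
  two_le_card : 2 ≤ Vodd.card

namespace ERWSetting

variable {d : ℕ} (𝓢 : ERWSetting d)

/-- `m`, the common cardinality of the two step sets. -/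
def m : ℕ := 𝓢.Vodd.card

/-- `V = V_odd ∪ V_even`, as a set. -/
def V : Set (EuclideanSpace ℝ (Fin d)) := {v | v ∈ 𝓢.Vodd ∨ v ∈ 𝓢.Veven}

/-- The directions admissible for the `k`-th step: `V_odd` for odd `k`, `V_even` for even `k`. -/
def dirs (k : ℕ) : Finset (EuclideanSpace ℝ (Fin d)) :=
  if Odd k then 𝓢.Vodd else 𝓢.Veven

open Classical in
/-- The probability that the `k`-th step is `w` (with `w ∈ dirs k`) when the remembered step is
`v ∈ V`.  If `v` is itself admissible at time `k`, it is repeated with probability `p`, and each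
other direction has probability `(1 - p) / (m - 1)`.  Otherwise `-v` is admissible; it is chosen
with probability `q`, and each other direction has probability `(1 - q) / (m - 1)`. -/
def stepProb (p q : ℝ) (k : ℕ) (v w : EuclideanSpace ℝ (Fin d)) : ℝ :=
  if v ∈ 𝓢.dirs k then
    if v = w then p else (1 - p) / ((𝓢.m : ℝ) - 1)
  else
    if -v = w then q else (1 - q) / ((𝓢.m : ℝ) - 1)

/-- `α = (m p - 1) / (m - 1)`. -/
def α (p : ℝ) : ℝ := ((𝓢.m : ℝ) * p - 1) / ((𝓢.m : ℝ) - 1)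

/-- `β = (m q - 1) / (m - 1)`. -/
def β (q : ℝ) : ℝ := ((𝓢.m : ℝ) * q - 1) / ((𝓢.m : ℝ) - 1)

/-- `γ = (α + β) / 2`. -/
def γ (p q : ℝ) : ℝ := (𝓢.α p + 𝓢.β q) / 2

/-- `δ = (α - β) / 2`. -/
def δ (p q : ℝ) : ℝ := (𝓢.α p - 𝓢.β q) / 2

/-- The mean of the directions in `V_odd`. -/
def vbar : EuclideanSpace ℝ (Fin d) := (1 / (𝓢.m : ℝ)) • ∑ v ∈ 𝓢.Vodd, v

/-- The matrix `1 / (m (1 - 2 δ)) * ∑_{v ∈ V_odd} (v - v̄) (v - v̄)ᵀ`. -/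
def limitCov (p q : ℝ) : Matrix (Fin d) (Fin d) ℝ :=
  (1 / ((𝓢.m : ℝ) * (1 - 2 * 𝓢.δ p q))) •
    ∑ v ∈ 𝓢.Vodd, Matrix.vecMulVec (⇑(v - 𝓢.vbar)) (⇑(v - 𝓢.vbar))

variable {Ω : Type*} [MeasurableSpace Ω]

/-- The σ-algebra generated by the randomness of step `n + 1`: `σ(X₁)` for `n = 0`, and
`σ(U_n, {G_{n+1}(v)}_{v ∈ V})` for `n ≥ 1`. -/
@[reducible] def innovation (X : ℕ → Ω → EuclideanSpace ℝ (Fin d)) (U : ℕ → Ω → ℕ)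
    (G : ℕ → EuclideanSpace ℝ (Fin d) → Ω → EuclideanSpace ℝ (Fin d)) (n : ℕ) :
    MeasurableSpace Ω :=
  if n = 0 then MeasurableSpace.comap (X 1) inferInstance
  else MeasurableSpace.comap (U n) inferInstance ⊔
    ⨆ v ∈ 𝓢.V, MeasurableSpace.comap (G (n + 1) v) inferInstance

/-- `X₁, X₂, …` are the increments of an elephant random walk with memory parameters `p`, `q`,
driven by the memory times `U_n` (`n ≥ 1`) and the step choices `G_k(v)` (`k ≥ 2`, `v ∈ V`).
The values `X 0`, `U 0`, `G 0`, `G 1` play no role.  The prescribed point masses have sum one, so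
that `X 1 ∈ V_odd`, `1 ≤ U n ≤ n` and `G k v ∈ dirs k` hold almost surely. -/
structure IsERW (P : Measure Ω) (p q : ℝ)
    (X : ℕ → Ω → EuclideanSpace ℝ (Fin d)) (U : ℕ → Ω → ℕ)
    (G : ℕ → EuclideanSpace ℝ (Fin d) → Ω → EuclideanSpace ℝ (Fin d)) : Prop where
  measurable_first : Measurable (X 1)
  measurable_memory : ∀ n ≥ 1, Measurable (U n)
  measurable_choice : ∀ k ≥ 2, ∀ v ∈ 𝓢.V, Measurable (G k v)
  /-- `X₁` is uniform on `V_odd`. -/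
  law_first : ∀ v ∈ 𝓢.Vodd, P.real {ω | X 1 ω = v} = 1 / (𝓢.m : ℝ)
  /-- `U_n` is uniform on `{1, …, n}`. -/
  law_memory : ∀ n ≥ 1, ∀ j ∈ Finset.Icc 1 n, P.real {ω | U n ω = j} = 1 / (n : ℝ)
  law_choice : ∀ k ≥ 2, ∀ v ∈ 𝓢.V, ∀ w ∈ 𝓢.dirs k,
    P.real {ω | G k v ω = w} = 𝓢.stepProb p q k v w
  /-- The random inputs of different steps are independent. -/
  indep_steps : iIndep (𝓢.innovation X U G) P
  /-- Within one step, the memory time is independent of the choice made for each given `v`. -/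
  indep_memory_choice : ∀ n ≥ 1, ∀ v ∈ 𝓢.V, IndepFun (U n) (G (n + 1) v) P
  step : ∀ n ≥ 1, ∀ᵐ ω ∂P, X (n + 1) ω = G (n + 1) (X (U n ω) ω) ω

end ERWSetting

/-- The position process with increments `X₁, X₂, …`: `S₀ = 0` and `S_{n+1} = S_n + X_{n+1}`. -/
def walkPosition {Ω : Type*} {d : ℕ} (X : ℕ → Ω → EuclideanSpace ℝ (Fin d)) :
    ℕ → Ω → EuclideanSpace ℝ (Fin d)
  | 0 => fun _ => 0
  | n + 1 => fun ω => walkPosition X n ω + X (n + 1) ω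

end

/-! Reflect the steps: $Y_k=(-1)^{k+1}X_k$ always lies in $V_{\rm odd}$. The law of a step given the
remembered one is a constant weight on all directions plus an atom of weight $\alpha$ or $\beta$ at
the remembered direction or its negative. A function $f$ with zero sum over $V_{\rm odd}$ sees only
the atom, so $x_k=f(Y_k)$ satisfies $E[x_{n+1}\mid\text{past}]=\gamma s_n/n+(-1)^n\delta\, a_n/n$,
where $s_n=\sum x_k$ and $a_n=\sum(-1)^{k-1}x_k$ (`AltReinforced`). With $f=\langle t,\cdot-\bar
v\rangle$, the quantity $\langle t,S_n\rangle$ differs from $a_n$ by a bounded term. Flipping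
alternate signs exchanges $s$ with $a$ and $\gamma$ with $\delta$, so a theorem about $s_n$ under
$\gamma<1/2$, $\delta<1$ is enough.

The alternating part of the drift averages out: adding the bounded correction $(\delta/2)(-1)^n
a_n/n$ to $s_n$ gives $A_n$, whose conditional mean one step later is $(1+\gamma/n)A_n+O(1/n)$. Two
consequences follow.

Law of large numbers: $E A_n^2/n^2$ obeys a contracting recursion if $\gamma<1$, so the drift tends
to $0$ in $L^2$. Applied to $f^2-s_0$, with $s_0$ the mean of $f^2$ over $V_{\rm odd}$, this shows
that the conditional variance of a step tends to $s_0$.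

Central limit theorem: $\varphi_n(s)=E\,e^{isA_n/\sqrt n}$ satisfies $\varphi_{n+1}(s)\approx
e^{-s^2s_0/(2(n+1))}\varphi_n(\rho_n s)$, with $\rho_n=(1+\gamma/n)\sqrt{n/(n+1)}$. The profile
$e^{-vs^2}$, $v=s_0/(2(1-2\gamma))$, almost solves the same recursion. The distance between them is
measured with the weight $|s|$: evaluation at $\rho_n s$ then yields a factor $|\rho_n|\le 1-c/n$,
because $\gamma<1/2$, and the distance vanishes. No martingale limit theorem is used. -/

/-! ### Recursive inequalities and elementary estimates. -/

open Topology in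
/-- A nonnegative sequence with `u (n+1) ≤ (1 - c/n) u n + e n / n`, `c > 0`, `e → 0`, vanishes. -/
theorem tendsto_zero_of_contraction {u e : ℕ → ℝ} {c : ℝ} (hc : 0 < c) (hu : ∀ n, 0 ≤ u n)
    (he : Tendsto e atTop (𝓝 0))
    (h : ∀ᶠ n : ℕ in atTop, u (n + 1) ≤ (1 - c / n) * u n + e n / n) :
    Tendsto u atTop (𝓝 0) := by
  rw [Metric.tendsto_atTop]
  intro η hη
  have he' : ∀ᶠ n in atTop, e n < c * (η / 2) := he.eventually_lt_const (by positivity)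
  obtain ⟨N, hN⟩ := eventually_atTop.1 (h.and (he'.and ((eventually_gt_atTop 0).and
    (tendsto_natCast_atTop_atTop.eventually_ge_atTop c))))
  -- The excess over the level `η / 2` obeys a homogeneous recursion, since from `N` on the
  -- perturbation is at most `c / n * (η / 2)`. The harmonic series diverges, so the exponential
  -- factor tends to zero.
  have key : ∀ k, u (N + k) - η / 2 ≤
      max (u N) 0 * Real.exp (-c * ∑ i ∈ Finset.range k, (1 / ((N + i : ℕ) : ℝ))) := by
    intro k
    induction k with
    | zero =>
      simp only [add_zero, Finset.range_zero, Finset.sum_empty, mul_zero, Real.exp_zero, mul_one]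
      have := le_max_left (u N) 0
      linarith
    | succ k ih =>
      obtain ⟨h1, h2, h3, h4⟩ := hN (N + k) (by omega)
      have hpos : (0 : ℝ) < ((N + k : ℕ) : ℝ) := by exact_mod_cast h3
      have hle : c / ((N + k : ℕ) : ℝ) ≤ 1 := by rw [div_le_one hpos]; exact h4
      have h5 : e (N + k) / ((N + k : ℕ) : ℝ) ≤ c / ((N + k : ℕ) : ℝ) * (η / 2) := by
        rw [div_mul_eq_mul_div]; gcongr
      have h6 : 1 - c / ((N + k : ℕ) : ℝ) ≤ Real.exp (-(c / ((N + k : ℕ) : ℝ))) := by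
        have := Real.add_one_le_exp (-(c / ((N + k : ℕ) : ℝ))); linarith
      set E := Real.exp (-c * ∑ i ∈ Finset.range k, (1 / ((N + i : ℕ) : ℝ)))
      calc u (N + (k + 1)) - η / 2
          ≤ (1 - c / ((N + k : ℕ) : ℝ)) * (u (N + k) - η / 2) := by
            have := h1; rw [← add_assoc]; nlinarith
        _ ≤ (1 - c / ((N + k : ℕ) : ℝ)) * (max (u N) 0 * E) :=
            mul_le_mul_of_nonneg_left ih (by linarith)
        _ ≤ Real.exp (-(c / ((N + k : ℕ) : ℝ))) * (max (u N) 0 * E) := by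
            gcongr
        _ = _ := by
            rw [Finset.sum_range_succ, mul_add, Real.exp_add]
            simp only [E]
            rw [show -(c / ((N + k : ℕ) : ℝ)) = -c * (1 / ((N + k : ℕ) : ℝ)) by ring]
            ring
  have hdiv : Tendsto (fun k => ∑ i ∈ Finset.range k, (1 / ((N + i : ℕ) : ℝ))) atTop atTop := by
    have h0 : ¬ Summable (fun i : ℕ => 1 / ((N + i : ℕ) : ℝ)) := by
      intro hs
      apply Real.not_summable_one_div_natCast
      rw [← summable_nat_add_iff N]
      simpa [add_comm] using hs
    exact (not_summable_iff_tendsto_nat_atTop_of_nonneg (fun i => by positivity)).1 h0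
  have hlim : Tendsto (fun k => max (u N) 0 *
      Real.exp (-c * ∑ i ∈ Finset.range k, (1 / ((N + i : ℕ) : ℝ)))) atTop (𝓝 0) := by
    have h := (Real.tendsto_exp_atBot.comp
      (hdiv.const_mul_atTop_of_neg (show -c < 0 by linarith))).const_mul (max (u N) 0)
    rwa [mul_zero] at h
  obtain ⟨K, hK⟩ := eventually_atTop.1 (hlim.eventually_lt_const (show (0 : ℝ) < η / 2 by positivity))
  refine ⟨N + K, fun n hn => ?_⟩
  obtain ⟨k, rfl⟩ := Nat.exists_eq_add_of_le (show N ≤ n by omega)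
  rw [Real.dist_eq, sub_zero, abs_of_nonneg (hu _)]
  have := key k
  have := hK k (by omega)
  linarith

theorem norm_cexp_I_mul_sub_one_sub_le (y : ℝ) :
    ‖Complex.exp (Complex.I * y) - (1 + Complex.I * y)‖ ≤ y ^ 2 * Real.exp |y| := by
  have := Complex.norm_exp_sub_sum_le_norm_mul_exp (Complex.I * y) 2
  simpa [Finset.sum_range_succ] using this

theorem norm_cexp_I_mul_sub_quadratic_le (y : ℝ) :
    ‖Complex.exp (Complex.I * y) - (1 + Complex.I * y - y ^ 2 / 2)‖ ≤ |y| ^ 3 * Real.exp |y| := by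
  have := Complex.norm_exp_sub_sum_le_norm_mul_exp (Complex.I * y) 3
  simpa [Finset.sum_range_succ, mul_pow, neg_div, ← sub_eq_add_neg] using this

theorem norm_cexp_I_mul_sub_cexp_I_mul_le (a b : ℝ) :
    ‖Complex.exp (Complex.I * a) - Complex.exp (Complex.I * b)‖ ≤ |a - b| := by
  have h : Complex.exp (Complex.I * a) - Complex.exp (Complex.I * b) =
      Complex.exp (Complex.I * b) * (Complex.exp (Complex.I * (a - b : ℝ)) - 1) := by
    rw [mul_sub, ← Complex.exp_add, mul_one]; congr 2; push_cast; ring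
  rw [h, norm_mul, Complex.norm_exp_I_mul_ofReal, one_mul]
  exact Real.norm_exp_I_mul_ofReal_sub_one_le

theorem abs_exp_neg_sub_exp_neg_le {a b : ℝ} (ha : 0 ≤ a) (hb : 0 ≤ b) :
    |Real.exp (-a) - Real.exp (-b)| ≤ |a - b| := by
  wlog hab : a ≤ b generalizing a b
  · rw [abs_sub_comm, abs_sub_comm a]; exact this hb ha (le_of_not_ge hab)
  have h1 : Real.exp (-b) ≤ Real.exp (-a) := Real.exp_le_exp.2 (by linarith)
  have h2 : Real.exp (-a) ≤ 1 := Real.exp_le_one_iff.2 (by linarith)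
  have h3 : Real.exp (-b) = Real.exp (-a) * Real.exp (-(b - a)) := by
    rw [← Real.exp_add]; congr 1; ring
  have h4 := Real.add_one_le_exp (-(b - a))
  rw [abs_of_nonneg (by linarith), abs_of_nonpos (by linarith), h3]
  nlinarith [Real.exp_pos (-a)]

theorem abs_one_sub_sub_exp_neg_le {a : ℝ} (ha : 0 ≤ a) : |1 - a - Real.exp (-a)| ≤ a ^ 2 := by
  have h1 := Real.add_one_le_exp (-a)
  have h2 : Real.exp (-a) ≤ 1 / (1 + a) := by
    rw [Real.exp_neg, ← one_div]
    exact one_div_le_one_div_of_le (by linarith) (by have := Real.add_one_le_exp a; linarith)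
  have h3 : 1 / (1 + a) ≤ 1 - a + a ^ 2 := by
    rw [div_le_iff₀ (by linarith)]; nlinarith [pow_nonneg ha 3]
  rw [abs_of_nonpos (by linarith)]; linarith

/-- Factors `((n + κ)/(n + 1))²` contract when `κ < 1`. -/
theorem eventually_sq_div_sq_le {κ : ℝ} (hκ : κ < 1) :
    ∀ᶠ n : ℕ in atTop, (((n : ℝ) + κ) / (n + 1)) ^ 2 ≤ 1 - ((1 - κ) / 2) / n := by
  filter_upwards [tendsto_natCast_atTop_atTop.eventually_ge_atTop (1 + |κ| : ℝ)] with n hn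
  have h1 := neg_abs_le κ
  have h0 : (0 : ℝ) < n := by have := abs_nonneg κ; linarith
  have h2 : 0 ≤ ((n : ℝ) + κ) / (n + 1) := div_nonneg (by linarith) (by linarith)
  have h3 : ((n : ℝ) + κ) / (n + 1) ≤ 1 - ((1 - κ) / 2) / n := by
    rw [div_le_iff₀ (by linarith)]
    have : (1 - κ) / 2 / n * (n + 1) = (1 - κ) / 2 + (1 - κ) / 2 / n := by field_simp
    have h4 : (1 - κ) / 2 / n ≤ (1 - κ) / 2 := div_le_self (by linarith) (by have := abs_nonneg κ; linarith)
    nlinarith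
  have h5 : 0 < (1 - κ) / 2 / n := div_pos (by linarith) h0
  nlinarith

/-- Factors `(1 + δ/n) √(n/(n+1))` contract when `δ < 1/2`. -/
theorem eventually_abs_mul_sqrt_div_sqrt_le {δ : ℝ} (hδ : δ < 1 / 2) :
    ∀ᶠ n : ℕ in atTop, |(1 + δ / n) * (√(n : ℝ) / √((n : ℝ) + 1))| ≤ 1 - ((1 - 2 * δ) / 8) / n := by
  filter_upwards [tendsto_natCast_atTop_atTop.eventually_ge_atTop
    (1 + |δ| + 4 * δ ^ 2 / (1 - 2 * δ) : ℝ)] with n hn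
  have h1 := neg_abs_le δ
  have hd : 0 < 1 - 2 * δ := by linarith
  have hq : 0 ≤ 4 * δ ^ 2 / (1 - 2 * δ) := by positivity
  have ha := abs_nonneg δ
  have h0 : (0 : ℝ) < n := by linarith
  have hs : √(n : ℝ) ^ 2 = n := Real.sq_sqrt h0.le
  have hs1 : √((n : ℝ) + 1) ^ 2 = n + 1 := Real.sq_sqrt (by linarith)
  have hb : (1 - 2 * δ) / 8 / n ≤ 1 := by
    rw [div_le_one h0]
    linarith
  refine abs_le_of_sq_le_sq' ?_ (by linarith) |> abs_le.2
  have h4 : 4 * δ ^ 2 ≤ (1 - 2 * δ) * n := by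
    have : 4 * δ ^ 2 / (1 - 2 * δ) ≤ n := by linarith
    rw [div_le_iff₀ hd] at this; linarith
  -- Squaring removes the roots. The first-order loss `1 - 2 * δ` of the square is where the
  -- threshold `1 / 2` comes from; the generous `1 / 8` absorbs the second-order terms.
  have h5 : ((1 + δ / n) * (√(n : ℝ) / √((n : ℝ) + 1))) ^ 2 =
      1 - ((1 - 2 * δ) - δ ^ 2 / n) / (n + 1) := by
    rw [mul_pow, div_pow, hs, hs1]; field_simp; ring
  have h6 : δ ^ 2 / n ≤ (1 - 2 * δ) / 4 := by rw [div_le_iff₀ h0]; linarith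
  have h7 : (1 - 2 * δ) / 4 / n ≤ ((1 - 2 * δ) - δ ^ 2 / n) / (n + 1) := by
    rw [div_le_div_iff₀ h0 (by linarith)]
    nlinarith
  rw [h5]
  have : 2 * ((1 - 2 * δ) / 8 / n) = (1 - 2 * δ) / 4 / n := by ring
  nlinarith [sq_nonneg ((1 - 2 * δ) / 8 / n)]

/-! ### Alternating reinforced sequences and the corrected sum. -/

section AltReinforced

variable {Ω : Type*} {mΩ : MeasurableSpace Ω}

/-- `x₁ + ⋯ + x_n`. -/
noncomputable def stepSum (x : ℕ → Ω → ℝ) (n : ℕ) (ω : Ω) : ℝ := ∑ k ∈ Finset.range n, x (k + 1) ω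

/-- `x₁ - x₂ + x₃ - ⋯ ± x_n`. -/
noncomputable def altSum (x : ℕ → Ω → ℝ) (n : ℕ) (ω : Ω) : ℝ :=
  ∑ k ∈ Finset.range n, (-1) ^ k * x (k + 1) ω

/-- The conditional mean of the `(n+1)`-st increment given the past. -/
noncomputable def altDrift (γ δ : ℝ) (x : ℕ → Ω → ℝ) (n : ℕ) (ω : Ω) : ℝ :=
  γ * (stepSum x n ω / n) + (-1) ^ n * δ * (altSum x n ω / n)

/-- A bounded adapted sequence whose conditional mean given the past is
`γ (x₁ + ⋯ + x_n) / n + (-1)^n δ (x₁ - x₂ + ⋯ ± x_n) / n`. -/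
structure AltReinforced (P : Measure Ω) (ℱ : Filtration ℕ mΩ) (γ δ C : ℝ) (x : ℕ → Ω → ℝ) :
    Prop where
  measurable' : ∀ n ≥ 1, Measurable[ℱ n] (x n)
  bound : ∀ n ≥ 1, ∀ ω, |x n ω| ≤ C
  cond : ∀ n ≥ 1, ∀ H : Ω → ℂ, Measurable[ℱ n] H → (∃ K, ∀ ω, ‖H ω‖ ≤ K) →
    ∫ ω, H ω * (x (n + 1) ω : ℂ) ∂P = ∫ ω, H ω * (altDrift γ δ x n ω : ℂ) ∂P

theorem integrable_of_measurable_of_abs_le {P : Measure Ω} [IsFiniteMeasure P] {f : Ω → ℝ}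
    (hf : Measurable f) (K : ℝ) (hK : ∀ ω, |f ω| ≤ K) : Integrable f P :=
  Integrable.of_bound hf.aestronglyMeasurable K (.of_forall fun ω => by simpa using hK ω)

theorem integrable_of_measurable_of_norm_le {P : Measure Ω} [IsFiniteMeasure P] {f : Ω → ℂ}
    (hf : Measurable f) (K : ℝ) (hK : ∀ ω, ‖f ω‖ ≤ K) : Integrable f P :=
  Integrable.of_bound hf.aestronglyMeasurable K (.of_forall hK)

theorem stepSum_succ (x : ℕ → Ω → ℝ) (n : ℕ) (ω : Ω) :
    stepSum x (n + 1) ω = stepSum x n ω + x (n + 1) ω := Finset.sum_range_succ _ _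

/-- The sequence with alternating signs. -/
noncomputable def signFlip (x : ℕ → Ω → ℝ) (k : ℕ) (ω : Ω) : ℝ := (-1) ^ (k + 1) * x k ω

theorem stepSum_signFlip (x : ℕ → Ω → ℝ) : stepSum (signFlip x) = altSum x := by
  funext n ω; simp [stepSum, altSum, signFlip, pow_succ]

theorem altSum_signFlip (x : ℕ → Ω → ℝ) : altSum (signFlip x) = stepSum x := by
  funext n ω
  simp only [stepSum, altSum, signFlip, pow_succ]
  refine Finset.sum_congr rfl fun k _ => ?_
  rcases neg_one_pow_eq_or ℝ k with h | h <;> simp [h]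

namespace AltReinforced

variable {P : Measure Ω} {ℱ : Filtration ℕ mΩ} {γ δ C : ℝ} {x : ℕ → Ω → ℝ}

theorem bound_nonneg (h : AltReinforced P ℱ γ δ C x) (ω : Ω) : 0 ≤ C :=
  (abs_nonneg _).trans (h.bound 1 le_rfl ω)

/-- The sign $(-1)^n$ carried by the new increment moves from the alternating term of the drift to
the plain one. Every result on `stepSum` thus has a twin on `altSum` with `γ` and `δ` exchanged. -/
theorem signFlip (h : AltReinforced P ℱ γ δ C x) : AltReinforced P ℱ δ γ C (signFlip x) where
  measurable' n hn := by
    have := h.measurable' n hn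
    exact this.const_mul _
  bound n hn ω := by
    simpa [_root_.signFlip, abs_mul] using h.bound n hn ω
  cond n hn H hH hK := by
    have h1 := h.cond n hn H hH hK
    have h2 : ∀ ω, H ω * ((_root_.signFlip x (n + 1) ω : ℝ) : ℂ) =
        (-1) ^ n * (H ω * (x (n + 1) ω : ℂ)) := by
      intro ω; simp only [_root_.signFlip]; push_cast; ring
    have h3 : ∀ ω, H ω * ((altDrift δ γ (_root_.signFlip x) n ω : ℝ) : ℂ) =
        (-1) ^ n * (H ω * (altDrift γ δ x n ω : ℂ)) := by
      intro ω
      simp only [altDrift, stepSum_signFlip, altSum_signFlip]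
      push_cast
      rcases neg_one_pow_eq_or ℂ n with h | h <;> rw [h] <;> ring
    simp_rw [h2, h3, integral_const_mul, h1]

theorem measurable (h : AltReinforced P ℱ γ δ C x) {n : ℕ} (hn : 1 ≤ n) : Measurable (x n) :=
  (h.measurable' n hn).mono (ℱ.le n) le_rfl

theorem measurable_stepSum' (h : AltReinforced P ℱ γ δ C x) (n : ℕ) :
    Measurable[ℱ n] (stepSum x n) := by
  refine Finset.measurable_fun_sum _ fun k hk => ?_
  exact (h.measurable' (k + 1) (by omega)).mono
    (ℱ.mono (by have := Finset.mem_range.1 hk; omega)) le_rfl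

theorem measurable_altSum' (h : AltReinforced P ℱ γ δ C x) (n : ℕ) :
    Measurable[ℱ n] (altSum x n) := by
  rw [← stepSum_signFlip]; exact h.signFlip.measurable_stepSum' n

theorem measurable_stepSum (h : AltReinforced P ℱ γ δ C x) (n : ℕ) : Measurable (stepSum x n) :=
  (h.measurable_stepSum' n).mono (ℱ.le n) le_rfl

theorem measurable_altSum (h : AltReinforced P ℱ γ δ C x) (n : ℕ) : Measurable (altSum x n) :=
  (h.measurable_altSum' n).mono (ℱ.le n) le_rfl

theorem measurable_altDrift (h : AltReinforced P ℱ γ δ C x) (n : ℕ) :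
    Measurable (altDrift γ δ x n) := by
  have h1 := h.measurable_stepSum n
  have h2 := h.measurable_altSum n
  unfold altDrift
  fun_prop

theorem abs_stepSum_le (h : AltReinforced P ℱ γ δ C x) (n : ℕ) (ω : Ω) :
    |stepSum x n ω| ≤ n * C := by
  refine (Finset.abs_sum_le_sum_abs _ _).trans ?_
  refine (Finset.sum_le_card_nsmul _ _ C fun k _ => h.bound (k + 1) (by omega) ω).trans ?_
  simp

theorem abs_stepSum_div_le (h : AltReinforced P ℱ γ δ C x) (n : ℕ) (ω : Ω) :
    |stepSum x n ω / n| ≤ C := by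
  rw [abs_div, Nat.abs_cast]
  exact div_le_of_le_mul₀ (by positivity) (h.bound_nonneg ω)
    ((h.abs_stepSum_le n ω).trans_eq (mul_comm _ _))

theorem abs_altSum_div_le (h : AltReinforced P ℱ γ δ C x) (n : ℕ) (ω : Ω) :
    |altSum x n ω / n| ≤ C := by
  rw [← stepSum_signFlip]; exact h.signFlip.abs_stepSum_div_le n ω

theorem abs_altDrift_le (h : AltReinforced P ℱ γ δ C x) (n : ℕ) (ω : Ω) :
    |altDrift γ δ x n ω| ≤ (|γ| + |δ|) * C := by
  unfold altDrift
  refine (abs_add_le _ _).trans ?_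
  rw [abs_mul, abs_mul, abs_mul, abs_neg_one_pow, one_mul, add_mul]
  gcongr
  · exact h.abs_stepSum_div_le n ω
  · exact h.abs_altSum_div_le n ω

theorem abs_stepSum_div_succ_sub_le (h : AltReinforced P ℱ γ δ C x) {n : ℕ} (hn : 1 ≤ n) (ω : Ω) :
    |stepSum x (n + 1) ω / ((n + 1 : ℕ) : ℝ) - stepSum x n ω / n| ≤ 2 * C / n := by
  have hn' : (0 : ℝ) < n := by exact_mod_cast hn
  have h1 : stepSum x (n + 1) ω / ((n + 1 : ℕ) : ℝ) - stepSum x n ω / n =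
      (x (n + 1) ω - stepSum x n ω / n) / (n + 1) := by
    rw [stepSum_succ]; push_cast; field_simp; ring
  have hC := h.bound_nonneg ω
  rw [h1, abs_div, abs_of_pos (show (0 : ℝ) < n + 1 by linarith)]
  have h2 : |x (n + 1) ω - stepSum x n ω / n| ≤ 2 * C := by
    refine (abs_sub _ _).trans ?_
    linarith [h.bound (n + 1) (by omega) ω, h.abs_stepSum_div_le n ω]
  gcongr
  linarith

theorem cond_real (h : AltReinforced P ℱ γ δ C x) {n : ℕ} (hn : 1 ≤ n) {H : Ω → ℝ}
    (hH : Measurable[ℱ n] H) (hK : ∃ K, ∀ ω, |H ω| ≤ K) :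
    ∫ ω, H ω * x (n + 1) ω ∂P = ∫ ω, H ω * altDrift γ δ x n ω ∂P := by
  have hm : Measurable[ℱ n] (fun ω => (H ω : ℂ)) := Complex.measurable_ofReal.comp hH
  have h1 := h.cond n hn (fun ω => (H ω : ℂ)) hm (by simpa using hK)
  simp_rw [← Complex.ofReal_mul] at h1
  rw [integral_complex_ofReal, integral_complex_ofReal] at h1
  exact_mod_cast h1

/-- `x₁ + ⋯ + x_n` with a correction that absorbs the alternating part of the drift. -/
noncomputable def correctedSum (κ : ℝ) (x : ℕ → Ω → ℝ) (n : ℕ) (ω : Ω) : ℝ :=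
  stepSum x n ω + (κ / 2) * (-1) ^ n * (altSum x n ω / n)

theorem measurable_correctedSum (h : AltReinforced P ℱ γ δ C x) (κ : ℝ) (n : ℕ) :
    Measurable (correctedSum κ x n) := by
  have h1 := h.measurable_stepSum n
  have h2 := h.measurable_altSum n
  unfold correctedSum
  fun_prop

theorem abs_correctedSum_sub_le (h : AltReinforced P ℱ γ δ C x) (κ : ℝ) (n : ℕ) (ω : Ω) :
    |correctedSum κ x n ω - stepSum x n ω| ≤ |κ| / 2 * C := by
  have h1 := h.abs_altSum_div_le n ω
  unfold correctedSum
  rw [add_sub_cancel_left, abs_mul, abs_mul, abs_neg_one_pow, mul_one, abs_div, abs_two]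
  gcongr

theorem abs_correctedSum_le (h : AltReinforced P ℱ γ δ C x) (κ : ℝ) {n : ℕ} (hn : 1 ≤ n) (ω : Ω) :
    |correctedSum κ x n ω| ≤ n * (C * (1 + |κ|)) := by
  have h1 := h.abs_correctedSum_sub_le κ n ω
  have h2 := h.abs_stepSum_le n ω
  have h3 := abs_add_le (correctedSum κ x n ω - stepSum x n ω) (stepSum x n ω)
  rw [sub_add_cancel] at h3
  have hC := h.bound_nonneg ω
  have hn' : (1 : ℝ) ≤ n := by exact_mod_cast hn
  have hk : 0 ≤ |κ| * C := by positivity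
  nlinarith

/-- The part of `correctedSum δ x (n+1)` known at time `n`. -/
noncomputable def predictor (δ : ℝ) (x : ℕ → Ω → ℝ) (n : ℕ) (ω : Ω) : ℝ :=
  stepSum x n ω - (δ / 2) * (-1) ^ n * (altSum x n ω / n)

theorem measurable_predictor' (h : AltReinforced P ℱ γ δ C x) (κ : ℝ) (n : ℕ) :
    Measurable[ℱ n] (predictor κ x n) := by
  have h1 := h.measurable_stepSum' n
  have h2 := h.measurable_altSum' n
  exact h1.sub ((h2.div_const _).const_mul _)

theorem abs_predictor_le (h : AltReinforced P ℱ γ δ C x) (κ : ℝ) {n : ℕ} (hn : 1 ≤ n) (ω : Ω) :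
    |predictor κ x n ω| ≤ n * (C * (1 + |κ|)) := by
  have h1 := h.abs_correctedSum_le (-κ) hn ω
  rw [abs_neg] at h1
  convert h1 using 2
  simp only [predictor, correctedSum]; ring

/-- The coefficient `δ / 2` is chosen for this: the correction changes sign at each step, and its
jump cancels half of the alternating drift twice over, leaving only the factor `1 + γ / n` up to an
error of order `1 / n`. -/
theorem predictor_add_altDrift (γ δ : ℝ) (x : ℕ → Ω → ℝ) {n : ℕ} (hn : 1 ≤ n) (ω : Ω) :
    predictor δ x n ω + altDrift γ δ x n ω = (1 + γ / n) * correctedSum δ x n ω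
      - γ * (δ / 2) * (-1) ^ n * (altSum x n ω / n) / n := by
  have hn' : (n : ℝ) ≠ 0 := by positivity
  simp only [predictor, correctedSum, altDrift]
  field_simp
  ring

end AltReinforced
end AltReinforced

/-! ### Second moments and the law of large numbers. -/

namespace AltReinforced

variable {Ω : Type*} {mΩ : MeasurableSpace Ω}
variable {P : Measure Ω} {ℱ : Filtration ℕ mΩ} {γ δ C : ℝ} {x : ℕ → Ω → ℝ}

/-- The predictor uses the average `altSum x n / n` in place of the next one, and averages of a
bounded sequence move by `O(1 / n)` per step. -/
theorem abs_correctedSum_succ_sub_le (h : AltReinforced P ℱ γ δ C x) (κ : ℝ) {n : ℕ} (hn : 1 ≤ n)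
    (ω : Ω) :
    |correctedSum κ x (n + 1) ω - (predictor κ x n ω + x (n + 1) ω)| ≤ |κ| * C / n := by
  have h1 := h.signFlip.abs_stepSum_div_succ_sub_le hn ω
  rw [stepSum_signFlip] at h1
  have h2 : correctedSum κ x (n + 1) ω - (predictor κ x n ω + x (n + 1) ω) =
      -(κ / 2) * (-1) ^ n *
        (altSum x (n + 1) ω / ((n + 1 : ℕ) : ℝ) - altSum x n ω / n) := by
    simp only [correctedSum, predictor, stepSum_succ, pow_succ]; ring
  rw [h2, abs_mul, abs_mul, abs_neg_one_pow, abs_neg, abs_div, abs_two, mul_one]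
  calc |κ| / 2 * _ ≤ |κ| / 2 * (2 * C / n) := by gcongr
    _ = |κ| * C / n := by ring

theorem abs_predictor_add_altDrift_sub_le (h : AltReinforced P ℱ γ δ C x) {n : ℕ} (hn : 1 ≤ n)
    (ω : Ω) :
    |predictor δ x n ω + altDrift γ δ x n ω - (1 + γ / n) * correctedSum δ x n ω| ≤
      |γ| * |δ| * C / n := by
  have h1 := h.abs_altSum_div_le n ω
  have hC := h.bound_nonneg ω
  rw [predictor_add_altDrift γ δ x hn, sub_sub_cancel_left, abs_neg, abs_div, abs_mul, abs_mul,
    abs_mul, abs_neg_one_pow, abs_div, abs_two, mul_one, Nat.abs_cast]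
  gcongr
  exact half_le_self (abs_nonneg _)

/-- An error of order `1 / n` against a quantity of order `n` changes the square by a bounded
amount, so the trivial linear bounds on the sums suffice. -/
theorem sq_le_sq_add_of_abs_sub_le {a b K L n : ℝ} (hn : 1 ≤ n) (hab : |a - b| ≤ K / n)
    (hb : |b| ≤ n * L) : a ^ 2 ≤ b ^ 2 + (2 * K * L + K ^ 2) := by
  have hn0 : 0 < n := by linarith
  have hK : 0 ≤ K := by
    have := (abs_nonneg _).trans hab
    by_contra hneg
    have := div_neg_of_neg_of_pos (not_le.1 hneg) hn0
    linarith
  have h1 : |a - b| * |b| ≤ K * L := by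
    calc |a - b| * |b| ≤ K / n * (n * L) := by gcongr
      _ = K * L := by field_simp
  have h2 : |a - b| ≤ K := hab.trans (div_le_self hK hn)
  have h3 : (a - b) * b ≤ K * L := (le_abs_self _).trans (by rwa [abs_mul])
  have h4 : (a - b) ^ 2 ≤ K ^ 2 := by rw [← sq_abs]; gcongr
  nlinarith

variable [IsProbabilityMeasure P]

/-- The cross terms agree because the predictor is known at time `n`; what remains is the second
moment of one increment. -/
theorem integral_sq_predictor_add_le (h : AltReinforced P ℱ γ δ C x) {n : ℕ} (hn : 1 ≤ n) :
    ∫ ω, (predictor δ x n ω + x (n + 1) ω) ^ 2 ∂P ≤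
      ∫ ω, (predictor δ x n ω + altDrift γ δ x n ω) ^ 2 ∂P + C ^ 2 := by
  have hB := h.measurable_predictor' δ n
  have hB' : Measurable (predictor δ x n) := hB.mono (ℱ.le n) le_rfl
  have hx := h.measurable (show 1 ≤ n + 1 by omega)
  have hm := h.measurable_altDrift n
  have bB := h.abs_predictor_le δ hn
  have bx := h.bound (n + 1) (by omega)
  have bm := h.abs_altDrift_le n
  set L : ℝ := n * (C * (1 + |δ|)) with hL
  have hcond := h.cond_real hn hB ⟨_, bB⟩
  have iBx : Integrable (fun ω => predictor δ x n ω * x (n + 1) ω) P :=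
    integrable_of_measurable_of_abs_le (hB'.mul hx) (L * C) fun ω => by
      rw [abs_mul]; gcongr
      exacts [(abs_nonneg _).trans (bB ω), bB ω, bx ω]
  have iBm : Integrable (fun ω => predictor δ x n ω * altDrift γ δ x n ω) P :=
    integrable_of_measurable_of_abs_le (hB'.mul hm) (L * ((|γ| + |δ|) * C)) fun ω => by
      rw [abs_mul]; gcongr
      exacts [(abs_nonneg _).trans (bB ω), bB ω, bm ω]
  have iBB : Integrable (fun ω => predictor δ x n ω ^ 2) P :=
    integrable_of_measurable_of_abs_le (hB'.pow_const 2) (L ^ 2) fun ω => by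
      rw [abs_pow]; have := bB ω; gcongr
  have ixx : Integrable (fun ω => x (n + 1) ω ^ 2) P :=
    integrable_of_measurable_of_abs_le (hx.pow_const 2) (C ^ 2) fun ω => by
      rw [abs_pow]; have := bx ω; gcongr
  have imm : Integrable (fun ω => altDrift γ δ x n ω ^ 2) P :=
    integrable_of_measurable_of_abs_le (hm.pow_const 2) (((|γ| + |δ|) * C) ^ 2) fun ω => by
      rw [abs_pow]; have := bm ω; gcongr
  have e1 : ∫ ω, (predictor δ x n ω + x (n + 1) ω) ^ 2 ∂P =
      ∫ ω, predictor δ x n ω ^ 2 ∂P + 2 * ∫ ω, predictor δ x n ω * x (n + 1) ω ∂P +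
        ∫ ω, x (n + 1) ω ^ 2 ∂P := by
    have i1 := iBB.add (iBx.const_mul 2)
    rw [← integral_const_mul, ← integral_add iBB (iBx.const_mul 2)]
    refine Eq.trans ?_ (integral_add i1 ixx)
    congr 1; funext ω; ring
  have e2 : ∫ ω, (predictor δ x n ω + altDrift γ δ x n ω) ^ 2 ∂P =
      ∫ ω, predictor δ x n ω ^ 2 ∂P + 2 * ∫ ω, predictor δ x n ω * altDrift γ δ x n ω ∂P +
        ∫ ω, altDrift γ δ x n ω ^ 2 ∂P := by
    have i1 := iBB.add (iBm.const_mul 2)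
    rw [← integral_const_mul, ← integral_add iBB (iBm.const_mul 2)]
    refine Eq.trans ?_ (integral_add i1 imm)
    congr 1; funext ω; ring
  have e3 : 0 ≤ ∫ ω, altDrift γ δ x n ω ^ 2 ∂P := integral_nonneg fun ω => sq_nonneg _
  have e4 : ∫ ω, x (n + 1) ω ^ 2 ∂P ≤ C ^ 2 := by
    calc ∫ ω, x (n + 1) ω ^ 2 ∂P ≤ ∫ ω, C ^ 2 ∂P :=
          integral_mono ixx (integrable_const _) fun ω => by
            have := bx ω; rw [← sq_abs]; gcongr
      _ = C ^ 2 := by simp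
  rw [e1, e2, hcond]; linarith

theorem integrable_correctedSum_sq (h : AltReinforced P ℱ γ δ C x) (κ : ℝ) {n : ℕ} (hn : 1 ≤ n) :
    Integrable (fun ω => correctedSum κ x n ω ^ 2) P :=
  integrable_of_measurable_of_abs_le ((h.measurable_correctedSum κ n).pow_const 2)
    ((n * (C * (1 + |κ|))) ^ 2) fun ω => by
      rw [abs_pow]; have := h.abs_correctedSum_le κ hn ω; gcongr

theorem exists_integral_sq_correctedSum_succ_le (h : AltReinforced P ℱ γ δ C x) :
    ∃ K : ℝ, ∀ n ≥ 1, ∫ ω, correctedSum δ x (n + 1) ω ^ 2 ∂P ≤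
      (1 + γ / n) ^ 2 * ∫ ω, correctedSum δ x n ω ^ 2 ∂P + K := by
  have hC : 0 ≤ C := by
    obtain ⟨ω⟩ := P.nonempty_of_neZero
    exact h.bound_nonneg ω
  set K₁ := 2 * (|δ| * C) * (C * (1 + |δ|) + C) + (|δ| * C) ^ 2
  set K₂ := 2 * (|γ| * |δ| * C) * ((1 + |γ|) * (C * (1 + |δ|))) + (|γ| * |δ| * C) ^ 2
  refine ⟨K₁ + C ^ 2 + K₂, fun n hn => ?_⟩
  have hn1 : (1 : ℝ) ≤ n := by exact_mod_cast hn
  have hn0 : (0 : ℝ) < n := by linarith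
  have hB' : Measurable (predictor δ x n) := (h.measurable_predictor' δ n).mono (ℱ.le n) le_rfl
  have hx := h.measurable (show 1 ≤ n + 1 by omega)
  have hm := h.measurable_altDrift n
  have bB := h.abs_predictor_le δ hn
  have bx := h.bound (n + 1) (by omega)
  have bm := h.abs_altDrift_le n
  have i1 : Integrable (fun ω => (predictor δ x n ω + x (n + 1) ω) ^ 2) P :=
    integrable_of_measurable_of_abs_le ((hB'.add hx).pow_const 2)
      ((n * (C * (1 + |δ|)) + C) ^ 2) fun ω => by
        rw [abs_pow]
        have := (abs_add_le _ _).trans (add_le_add (bB ω) (bx ω))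
        gcongr
  have i2 : Integrable (fun ω => (predictor δ x n ω + altDrift γ δ x n ω) ^ 2) P :=
    integrable_of_measurable_of_abs_le ((hB'.add hm).pow_const 2)
      ((n * (C * (1 + |δ|)) + (|γ| + |δ|) * C) ^ 2) fun ω => by
        rw [abs_pow]
        have := (abs_add_le _ _).trans (add_le_add (bB ω) (bm ω))
        gcongr
  have s1 : ∫ ω, correctedSum δ x (n + 1) ω ^ 2 ∂P ≤
      ∫ ω, (predictor δ x n ω + x (n + 1) ω) ^ 2 ∂P + K₁ := by
    calc _ ≤ ∫ ω, ((predictor δ x n ω + x (n + 1) ω) ^ 2 + K₁) ∂P := by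
          refine integral_mono (h.integrable_correctedSum_sq δ (by omega))
            (i1.add (integrable_const _)) fun ω => ?_
          refine sq_le_sq_add_of_abs_sub_le hn1 (h.abs_correctedSum_succ_sub_le δ hn ω) ?_
          refine (abs_add_le _ _).trans ?_
          have := bB ω
          have := bx ω
          nlinarith
      _ = _ := by rw [integral_add i1 (integrable_const _)]; simp
  have s2 : ∫ ω, (predictor δ x n ω + altDrift γ δ x n ω) ^ 2 ∂P ≤
      (1 + γ / n) ^ 2 * ∫ ω, correctedSum δ x n ω ^ 2 ∂P + K₂ := by
    have i3 := (h.integrable_correctedSum_sq δ hn).const_mul ((1 + γ / n) ^ 2)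
    calc _ ≤ ∫ ω, ((1 + γ / n) ^ 2 * correctedSum δ x n ω ^ 2 + K₂) ∂P := by
          refine integral_mono i2 (i3.add (integrable_const _)) fun ω => ?_
          change _ ≤ (1 + γ / n) ^ 2 * correctedSum δ x n ω ^ 2 + K₂
          rw [← mul_pow]
          refine sq_le_sq_add_of_abs_sub_le hn1 (h.abs_predictor_add_altDrift_sub_le hn ω) ?_
          rw [abs_mul]
          have g1 : |1 + γ / n| ≤ 1 + |γ| := by
            refine (abs_add_le _ _).trans ?_
            rw [abs_one, abs_div, Nat.abs_cast]
            gcongr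
            exact div_le_self (abs_nonneg _) hn1
          have := h.abs_correctedSum_le δ hn ω
          calc _ ≤ (1 + |γ|) * (n * (C * (1 + |δ|))) := by gcongr
            _ = _ := by ring
      _ = _ := by rw [integral_add i3 (integrable_const _), integral_const_mul]; simp
  have s3 := h.integral_sq_predictor_add_le hn
  linarith

-- Dividing the second-moment recursion by `(n + 1) ^ 2` turns the factor into `((n + γ) / (n + 1))
-- ^ 2`, which contracts exactly because `γ < 1`. The bounded correction does not matter after
-- division by `n`.
open Topology in
theorem tendsto_integral_sq_stepSum_div (h : AltReinforced P ℱ γ δ C x) (hγ : γ < 1) :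
    Tendsto (fun n : ℕ => ∫ ω, (stepSum x n ω / n) ^ 2 ∂P) atTop (𝓝 0) := by
  obtain ⟨K, hK⟩ := h.exists_integral_sq_correctedSum_succ_le
  have hu : Tendsto (fun n : ℕ => (∫ ω, correctedSum δ x n ω ^ 2 ∂P) / (n : ℝ) ^ 2) atTop (𝓝 0) := by
    refine tendsto_zero_of_contraction (c := (1 - γ) / 2) (e := fun n : ℕ => |K| / n) (by linarith)
      (fun n => div_nonneg (integral_nonneg fun ω => sq_nonneg _) (by positivity))
      (tendsto_const_div_atTop_nhds_zero_nat _) ?_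
    filter_upwards [eventually_sq_div_sq_le hγ, eventually_ge_atTop 1] with n h1 hn
    have hn1 : (1 : ℝ) ≤ n := by exact_mod_cast hn
    have hn0 : (n : ℝ) ≠ 0 := by positivity
    set e := ∫ ω, correctedSum δ x n ω ^ 2 ∂P
    have he : 0 ≤ e := integral_nonneg fun ω => sq_nonneg _
    calc _ ≤ ((1 + γ / n) ^ 2 * e + K) / ((n + 1 : ℕ) : ℝ) ^ 2 := by gcongr; exact hK n hn
      _ = (((n : ℝ) + γ) / (n + 1)) ^ 2 * (e / (n : ℝ) ^ 2) + K / ((n : ℝ) + 1) ^ 2 := by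
          push_cast; field_simp
      _ ≤ (1 - (1 - γ) / 2 / n) * (e / (n : ℝ) ^ 2) + |K| / n / n := by
          refine add_le_add (by gcongr) ?_
          rw [div_div]
          exact div_le_div₀ (abs_nonneg K) (le_abs_self K) (by nlinarith) (by nlinarith)
  have hb : Tendsto (fun n : ℕ => 2 * ((∫ ω, correctedSum δ x n ω ^ 2 ∂P) / (n : ℝ) ^ 2) +
      2 * (|δ| / 2 * C) ^ 2 / n) atTop (𝓝 0) := by
    simpa using (hu.const_mul 2).add (tendsto_const_div_atTop_nhds_zero_nat (2 * (|δ| / 2 * C) ^ 2))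
  refine squeeze_zero' (.of_forall fun n => integral_nonneg fun ω => sq_nonneg _) ?_ hb
  filter_upwards [eventually_ge_atTop 1] with n hn
  have hn1 : (1 : ℝ) ≤ n := by exact_mod_cast hn
  have i1 := ((h.integrable_correctedSum_sq δ hn).const_mul (2 / (n : ℝ) ^ 2))
  have hS : Integrable (fun ω => (stepSum x n ω / n) ^ 2) P :=
    integrable_of_measurable_of_abs_le (((h.measurable_stepSum n).div_const _).pow_const 2) (C ^ 2)
      fun ω => by rw [abs_pow]; have := h.abs_stepSum_div_le n ω; gcongr
  calc _ ≤ ∫ ω, (2 / (n : ℝ) ^ 2 * correctedSum δ x n ω ^ 2 + 2 * (|δ| / 2 * C) ^ 2 / n) ∂P := by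
        refine integral_mono hS (i1.add (integrable_const _)) fun ω => ?_
        change _ ≤ 2 / (n : ℝ) ^ 2 * correctedSum δ x n ω ^ 2 + 2 * (|δ| / 2 * C) ^ 2 / n
        have g1 : (correctedSum δ x n ω - stepSum x n ω) ^ 2 ≤ (|δ| / 2 * C) ^ 2 := by
          rw [← sq_abs]; have := h.abs_correctedSum_sub_le δ n ω; gcongr
        have g2 : stepSum x n ω ^ 2 ≤ 2 * correctedSum δ x n ω ^ 2 + 2 * (|δ| / 2 * C) ^ 2 := by
          nlinarith [sq_nonneg (2 * correctedSum δ x n ω - stepSum x n ω)]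
        calc (stepSum x n ω / n) ^ 2 = stepSum x n ω ^ 2 / (n : ℝ) ^ 2 := div_pow _ _ _
          _ ≤ (2 * correctedSum δ x n ω ^ 2 + 2 * (|δ| / 2 * C) ^ 2) / (n : ℝ) ^ 2 := by gcongr
          _ = 2 / (n : ℝ) ^ 2 * correctedSum δ x n ω ^ 2 +
              2 * (|δ| / 2 * C) ^ 2 / (n : ℝ) ^ 2 := by ring
          _ ≤ _ := by gcongr; nlinarith
    _ = _ := by
        rw [integral_add i1 (integrable_const _), integral_const_mul]; simp; ring

-- The drift combines two averages; the sign flip reduces the alternating one to the plain one, with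
-- `δ < 1` in the role of `γ < 1`.
open Topology in
theorem tendsto_integral_sq_altDrift (h : AltReinforced P ℱ γ δ C x) (hγ : γ < 1) (hδ : δ < 1) :
    Tendsto (fun n : ℕ => ∫ ω, altDrift γ δ x n ω ^ 2 ∂P) atTop (𝓝 0) := by
  have h1 := h.tendsto_integral_sq_stepSum_div hγ
  have h2 := h.signFlip.tendsto_integral_sq_stepSum_div hδ
  rw [stepSum_signFlip] at h2
  have h3 := (h1.const_mul (2 * γ ^ 2)).add (h2.const_mul (2 * δ ^ 2))
  simp only [mul_zero, add_zero] at h3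
  refine squeeze_zero (fun n => integral_nonneg fun ω => sq_nonneg _) (fun n => ?_) h3
  have i1 : Integrable (fun ω => (stepSum x n ω / n) ^ 2) P :=
    integrable_of_measurable_of_abs_le (((h.measurable_stepSum n).div_const _).pow_const 2) (C ^ 2)
      fun ω => by rw [abs_pow]; have := h.abs_stepSum_div_le n ω; gcongr
  have i2 : Integrable (fun ω => (altSum x n ω / n) ^ 2) P :=
    integrable_of_measurable_of_abs_le (((h.measurable_altSum n).div_const _).pow_const 2) (C ^ 2)
      fun ω => by rw [abs_pow]; have := h.abs_altSum_div_le n ω; gcongr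
  have im : Integrable (fun ω => altDrift γ δ x n ω ^ 2) P :=
    integrable_of_measurable_of_abs_le ((h.measurable_altDrift n).pow_const 2)
      (((|γ| + |δ|) * C) ^ 2) fun ω => by
        rw [abs_pow]; have := h.abs_altDrift_le n ω; gcongr
  rw [← integral_const_mul, ← integral_const_mul,
    ← integral_add (i1.const_mul _) (i2.const_mul _)]
  refine integral_mono im ((i1.const_mul _).add (i2.const_mul _)) fun ω => ?_
  simp only [altDrift]
  rcases neg_one_pow_eq_or ℝ n with h | h <;> rw [h] <;>
    nlinarith [sq_nonneg (γ * (stepSum x n ω / n) - δ * (altSum x n ω / n)),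
      sq_nonneg (γ * (stepSum x n ω / n) + δ * (altSum x n ω / n))]

end AltReinforced

/-! ### One step of the characteristic function. -/

namespace AltReinforced

variable {Ω : Type*} {mΩ : MeasurableSpace Ω}
variable {P : Measure Ω} {ℱ : Filtration ℕ mΩ} {γ δ C γ' δ' C' s₀ : ℝ} {x : ℕ → Ω → ℝ}

/-- Reassembles a second-order expansion into a Gaussian factor times a phase. Errors are either
cubic in `θ`, or `θ ^ 2` times `m ^ 2` or `|z|`, which will be the squared drift of the sequence and
the drift of its centred squares, both vanishing in mean. -/
theorem norm_quadratic_sub_exp_le {θ m z s₀ : ℝ} (hs : 0 ≤ s₀) (hθ : |θ| ≤ 1) :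
    ‖(1 + Complex.I * ((θ * m : ℝ) : ℂ) - θ ^ 2 / 2 * (s₀ + z)) -
      ((Real.exp (-(θ ^ 2 * s₀ / 2)) : ℝ) : ℂ) * Complex.exp (Complex.I * ((θ * m : ℝ) : ℂ))‖ ≤
    |θ| ^ 3 * (s₀ ^ 2 + s₀ * |m|) + θ ^ 2 * (Real.exp |m| * m ^ 2 + |z|) := by
  set E := Complex.exp (Complex.I * ((θ * m : ℝ) : ℂ)) with hE
  set g := Real.exp (-(θ ^ 2 * s₀ / 2))
  have h1 := norm_cexp_I_mul_sub_one_sub_le (θ * m)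
  rw [← hE, norm_sub_rev] at h1
  have ha : 0 ≤ θ ^ 2 * s₀ / 2 := by positivity
  have h2 : ‖((1 - θ ^ 2 * s₀ / 2 - g : ℝ) : ℂ)‖ ≤ (θ ^ 2 * s₀ / 2) ^ 2 := by
    rw [Complex.norm_real]; exact abs_one_sub_sub_exp_neg_le ha
  have h3 : ‖((1 - g : ℝ) : ℂ)‖ ≤ θ ^ 2 * s₀ / 2 := by
    rw [Complex.norm_real, Real.norm_eq_abs]
    have := abs_exp_neg_sub_exp_neg_le le_rfl ha
    rwa [neg_zero, Real.exp_zero, zero_sub, abs_neg, abs_of_nonneg ha] at this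
  have h4 : ‖E - 1‖ ≤ |θ| * |m| := by
    rw [hE, ← abs_mul]; exact Real.norm_exp_I_mul_ofReal_sub_one_le
  have h5 : ‖((θ ^ 2 / 2 * z : ℝ) : ℂ)‖ ≤ θ ^ 2 * |z| := by
    rw [Complex.norm_real, Real.norm_eq_abs, abs_mul, abs_of_nonneg (by positivity)]
    have := sq_nonneg θ
    gcongr
    linarith
  have key : (1 + Complex.I * ((θ * m : ℝ) : ℂ) - θ ^ 2 / 2 * (s₀ + z)) - (g : ℂ) * E =
      (1 + Complex.I * ((θ * m : ℝ) : ℂ) - E) + ((1 - θ ^ 2 * s₀ / 2 - g : ℝ) : ℂ) +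
        ((1 - g : ℝ) : ℂ) * (E - 1) - ((θ ^ 2 / 2 * z : ℝ) : ℂ) := by
    push_cast; ring
  rw [key]
  have hθ0 := abs_nonneg θ
  have hθ2 : θ ^ 2 = |θ| ^ 2 := (sq_abs θ).symm
  have t1 : (θ * m) ^ 2 * Real.exp |θ * m| ≤ θ ^ 2 * (Real.exp |m| * m ^ 2) := by
    rw [mul_pow, abs_mul]
    have : Real.exp (|θ| * |m|) ≤ Real.exp |m| :=
      Real.exp_le_exp.2 (mul_le_of_le_one_left (abs_nonneg _) hθ)
    calc θ ^ 2 * m ^ 2 * Real.exp (|θ| * |m|) ≤ θ ^ 2 * m ^ 2 * Real.exp |m| := by gcongr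
      _ = _ := by ring
  have t2 : (θ ^ 2 * s₀ / 2) ^ 2 ≤ |θ| ^ 3 * s₀ ^ 2 := by
    calc (θ ^ 2 * s₀ / 2) ^ 2 = |θ| ^ 3 * s₀ ^ 2 * (|θ| / 4) := by rw [hθ2]; ring
      _ ≤ |θ| ^ 3 * s₀ ^ 2 * 1 := by gcongr; linarith
      _ = _ := mul_one _
  have t3 : ‖((1 - g : ℝ) : ℂ) * (E - 1)‖ ≤ |θ| ^ 3 * (s₀ * |m|) := by
    rw [norm_mul]
    calc _ ≤ (θ ^ 2 * s₀ / 2) * (|θ| * |m|) := by gcongr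
      _ = |θ| ^ 3 * (s₀ * |m|) / 2 := by rw [hθ2]; ring
      _ ≤ _ := half_le_self (by positivity)
  calc _ ≤ ‖1 + Complex.I * ((θ * m : ℝ) : ℂ) - E‖ + ‖((1 - θ ^ 2 * s₀ / 2 - g : ℝ) : ℂ)‖ +
        ‖((1 - g : ℝ) : ℂ) * (E - 1)‖ + ‖((θ ^ 2 / 2 * z : ℝ) : ℂ)‖ :=
      (norm_sub_le _ _).trans (by gcongr; exact norm_add₃_le)
    _ ≤ θ ^ 2 * (Real.exp |m| * m ^ 2) + |θ| ^ 3 * s₀ ^ 2 + |θ| ^ 3 * (s₀ * |m|) + θ ^ 2 * |z| := by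
      gcongr
      exacts [h1.trans t1, h2.trans t2]
    _ = _ := by ring

variable [IsProbabilityMeasure P]

theorem measurable_cexp_I_mul {f : Ω → ℝ} {m : MeasurableSpace Ω} (hf : Measurable[m] f) :
    Measurable[m] (fun ω => Complex.exp (Complex.I * (f ω : ℂ))) :=
  Complex.measurable_exp.comp ((Complex.measurable_ofReal.comp hf).const_mul _)

theorem integrable_cexp_I_mul {f : Ω → ℝ} (hf : Measurable f) :
    Integrable (fun ω => Complex.exp (Complex.I * (f ω : ℂ))) P :=
  integrable_of_measurable_of_norm_le (measurable_cexp_I_mul hf) 1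
    fun ω => (Complex.norm_exp_I_mul_ofReal (f ω)).le

theorem norm_integral_cexp_I_mul_sub_le {f g : Ω → ℝ} (hf : Measurable f) (hg : Measurable g)
    {K : ℝ} (hK : ∀ ω, |f ω - g ω| ≤ K) :
    ‖∫ ω, Complex.exp (Complex.I * (f ω : ℂ)) ∂P - ∫ ω, Complex.exp (Complex.I * (g ω : ℂ)) ∂P‖
      ≤ K := by
  rw [← integral_sub (integrable_cexp_I_mul hf) (integrable_cexp_I_mul hg)]
  refine (norm_integral_le_of_norm_le_const (C := K) (.of_forall fun ω =>
    (norm_cexp_I_mul_sub_cexp_I_mul_le (f ω) (g ω)).trans (hK ω))).trans ?_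
  simp

/-- Replacing the increment by its conditional mean costs a Gaussian factor. -/
theorem norm_integral_cexp_step_le (h : AltReinforced P ℱ γ δ C x)
    (hz : AltReinforced P ℱ γ' δ' C' (fun k ω => x k ω ^ 2 - s₀)) (hs : 0 ≤ s₀)
    {n : ℕ} (hn : 1 ≤ n) {B : Ω → ℝ} (hB : Measurable[ℱ n] B) {θ : ℝ} (hθ : |θ| ≤ 1) :
    ‖∫ ω, Complex.exp (Complex.I * ((θ * (B ω + x (n + 1) ω) : ℝ) : ℂ)) ∂P -
      ((Real.exp (-(θ ^ 2 * s₀ / 2)) : ℝ) : ℂ) *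
        ∫ ω, Complex.exp (Complex.I * ((θ * (B ω + altDrift γ δ x n ω) : ℝ) : ℂ)) ∂P‖ ≤
    |θ| ^ 3 * (C ^ 3 * Real.exp C + s₀ ^ 2 + s₀ * ((|γ| + |δ|) * C)) +
      θ ^ 2 * (Real.exp ((|γ| + |δ|) * C) * ∫ ω, altDrift γ δ x n ω ^ 2 ∂P +
        ∫ ω, |altDrift γ' δ' (fun k ω => x k ω ^ 2 - s₀) n ω| ∂P) := by
  set z : ℕ → Ω → ℝ := fun k ω => x k ω ^ 2 - s₀ with hzdef
  set m := altDrift γ δ x n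
  set r := altDrift γ' δ' z n
  set M := (|γ| + |δ|) * C
  set g := Real.exp (-(θ ^ 2 * s₀ / 2))
  set H : Ω → ℂ := fun ω => Complex.exp (Complex.I * ((θ * B ω : ℝ) : ℂ)) with hHdef
  have hH : Measurable[ℱ n] H := measurable_cexp_I_mul (hB.const_mul θ)
  have hH' : Measurable H := hH.mono (ℱ.le n) le_rfl
  have hH1 : ∀ ω, ‖H ω‖ = 1 := fun ω => Complex.norm_exp_I_mul_ofReal _
  have hx := h.measurable (show 1 ≤ n + 1 by omega)
  have hzm := hz.measurable (show 1 ≤ n + 1 by omega)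
  have hm : Measurable m := h.measurable_altDrift n
  have hr : Measurable r := hz.measurable_altDrift n
  have hB' : Measurable B := hB.mono (ℱ.le n) le_rfl
  have bx := h.bound (n + 1) (by omega)
  have bz := hz.bound (n + 1) (by omega)
  have bm : ∀ ω, |m ω| ≤ M := h.abs_altDrift_le n
  have br : ∀ ω, |r ω| ≤ _ := hz.abs_altDrift_le n
  have iH : Integrable H P := integrable_of_measurable_of_norm_le hH' 1 fun ω => (hH1 ω).le
  have iHf : ∀ {f : Ω → ℝ}, Measurable f → ∀ K, (∀ ω, |f ω| ≤ K) →
      Integrable (fun ω => H ω * (f ω : ℂ)) P := fun hf K hK =>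
    integrable_of_measurable_of_norm_le (hH'.mul (Complex.measurable_ofReal.comp hf)) K fun ω => by
      rw [norm_mul, hH1, one_mul, Complex.norm_real]; exact hK ω
  have iX := iHf hx C bx
  have iZ := iHf hzm C' bz
  have iM := iHf hm M bm
  have iR := iHf hr _ br
  have expand : ∀ {a b : Ω → ℝ}, Integrable (fun ω => H ω * (a ω : ℂ)) P →
      Integrable (fun ω => H ω * (b ω : ℂ)) P →
      Integrable (fun ω => H ω * (1 + Complex.I * ((θ * a ω : ℝ) : ℂ) - θ ^ 2 / 2 * (s₀ + b ω))) P ∧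
      ∫ ω, H ω * (1 + Complex.I * ((θ * a ω : ℝ) : ℂ) - θ ^ 2 / 2 * (s₀ + b ω)) ∂P =
        (1 - θ ^ 2 / 2 * s₀) * ∫ ω, H ω ∂P + Complex.I * θ * ∫ ω, H ω * (a ω : ℂ) ∂P -
          θ ^ 2 / 2 * ∫ ω, H ω * (b ω : ℂ) ∂P := by
    intro a b ia ib
    have i1 := (iH.const_mul (1 - (θ : ℂ) ^ 2 / 2 * s₀)).add (ia.const_mul (Complex.I * θ))
    have i2 := i1.sub (ib.const_mul ((θ : ℂ) ^ 2 / 2))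
    have e : (fun ω => H ω * (1 + Complex.I * ((θ * a ω : ℝ) : ℂ) - θ ^ 2 / 2 * (s₀ + b ω))) =
        ((fun ω => (1 - (θ : ℂ) ^ 2 / 2 * s₀) * H ω) + fun ω => Complex.I * θ * (H ω * (a ω : ℂ))) -
          fun ω => (θ : ℂ) ^ 2 / 2 * (H ω * (b ω : ℂ)) := by
      funext ω; simp only [Pi.add_apply, Pi.sub_apply]; push_cast; ring
    refine ⟨by rw [e]; exact i2, ?_⟩
    rw [e, integral_sub' i1 (ib.const_mul _),
      integral_add' (iH.const_mul _) (ia.const_mul _), integral_const_mul, integral_const_mul,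
      integral_const_mul]
  obtain ⟨iXZ, eXZ⟩ := expand iX iZ
  obtain ⟨iMR, eMR⟩ := expand iM iR
  have hcx := h.cond n hn H hH ⟨1, fun ω => (hH1 ω).le⟩
  have hcz := hz.cond n hn H hH ⟨1, fun ω => (hH1 ω).le⟩
  -- The conditional means of the increment and of its centred square let both be replaced by their
  -- drifts inside the quadratic expansion, with no error.
  have heq := eXZ.trans ((by rw [hcx, hcz] : _ = _).trans eMR.symm)
  have split : ∀ a : Ω → ℝ, ∀ ω, Complex.exp (Complex.I * ((θ * (B ω + a ω) : ℝ) : ℂ)) =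
      H ω * Complex.exp (Complex.I * ((θ * a ω : ℝ) : ℂ)) := by
    intro a ω
    rw [hHdef, ← Complex.exp_add]; congr 1; push_cast; ring
  have iE1 : Integrable (fun ω => Complex.exp (Complex.I * ((θ * (B ω + x (n + 1) ω) : ℝ) : ℂ))) P :=
    integrable_cexp_I_mul ((hB'.add hx).const_mul θ)
  have iE2 : Integrable (fun ω => Complex.exp (Complex.I * ((θ * (B ω + m ω) : ℝ) : ℂ))) P :=
    integrable_cexp_I_mul ((hB'.add hm).const_mul θ)
  have first : ‖∫ ω, Complex.exp (Complex.I * ((θ * (B ω + x (n + 1) ω) : ℝ) : ℂ)) ∂P -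
      ∫ ω, H ω * (1 + Complex.I * ((θ * x (n + 1) ω : ℝ) : ℂ) -
        θ ^ 2 / 2 * (s₀ + z (n + 1) ω)) ∂P‖ ≤ |θ| ^ 3 * (C ^ 3 * Real.exp C) := by
    rw [← integral_sub iE1 iXZ]
    refine (norm_integral_le_of_norm_le_const (C := |θ| ^ 3 * (C ^ 3 * Real.exp C))
      (.of_forall fun ω => ?_)).trans (by simp)
    rw [split, ← mul_sub, norm_mul, hH1, one_mul]
    have h1 := norm_cexp_I_mul_sub_quadratic_le (θ * x (n + 1) ω)
    -- By definition of `z`, the square of the increment is `s₀ + z`.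
    have h2 : (1 + Complex.I * ((θ * x (n + 1) ω : ℝ) : ℂ) - ((θ * x (n + 1) ω : ℝ) : ℂ) ^ 2 / 2) =
        1 + Complex.I * ((θ * x (n + 1) ω : ℝ) : ℂ) - θ ^ 2 / 2 * (s₀ + z (n + 1) ω) := by
      simp only [hzdef]; push_cast; ring
    rw [h2] at h1
    refine h1.trans ?_
    have hb := bx ω
    have hC := h.bound_nonneg ω
    rw [abs_mul, mul_pow, mul_assoc]
    gcongr
    calc |θ| * |x (n + 1) ω| ≤ 1 * C := by gcongr
      _ = C := one_mul C
  have second : ‖∫ ω, H ω * (1 + Complex.I * ((θ * m ω : ℝ) : ℂ) - θ ^ 2 / 2 * (s₀ + r ω)) ∂P -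
      (g : ℂ) * ∫ ω, Complex.exp (Complex.I * ((θ * (B ω + m ω) : ℝ) : ℂ)) ∂P‖ ≤
      |θ| ^ 3 * (s₀ ^ 2 + s₀ * M) +
        θ ^ 2 * (Real.exp M * ∫ ω, m ω ^ 2 ∂P + ∫ ω, |r ω| ∂P) := by
    have im2 : Integrable (fun ω => m ω ^ 2) P :=
      integrable_of_measurable_of_abs_le (hm.pow_const 2) (M ^ 2) fun ω => by
        rw [abs_pow]; have := bm ω; gcongr
    have ir : Integrable (fun ω => |r ω|) P :=
      (integrable_of_measurable_of_abs_le hr _ br).abs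
    rw [← integral_const_mul, ← integral_sub iMR (iE2.const_mul _)]
    have ib : Integrable (fun ω => θ ^ 2 * (Real.exp M * m ω ^ 2 + |r ω|)) P :=
      ((im2.const_mul (Real.exp M)).add ir).const_mul (θ ^ 2)
    refine (norm_integral_le_of_norm_le (g := fun ω => |θ| ^ 3 * (s₀ ^ 2 + s₀ * M) +
      θ ^ 2 * (Real.exp M * m ω ^ 2 + |r ω|)) ((integrable_const _).add ib)
      (.of_forall fun ω => ?_)).trans_eq ?_
    · rw [split, mul_left_comm, ← mul_sub, norm_mul, hH1, one_mul]
      refine (norm_quadratic_sub_exp_le hs hθ).trans ?_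
      have := bm ω
      gcongr
    · rw [integral_add (integrable_const _) ib, integral_const_mul (θ ^ 2),
        integral_add (im2.const_mul _) ir, integral_const_mul (Real.exp M)]
      simp
  rw [heq] at first
  refine (norm_sub_le_norm_sub_add_norm_sub _ _ _).trans ((add_le_add first second).trans_eq ?_)
  ring

theorem integral_abs_le_sqrt {f : Ω → ℝ} (hf : Measurable f) {K : ℝ} (hK : ∀ ω, |f ω| ≤ K) :
    ∫ ω, |f ω| ∂P ≤ √(∫ ω, f ω ^ 2 ∂P) := by
  apply Real.le_sqrt_of_sq_le
  have i1 : Integrable (fun ω => |f ω|) P := (integrable_of_measurable_of_abs_le hf K hK).abs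
  have i2 : Integrable (fun ω => f ω ^ 2) P :=
    integrable_of_measurable_of_abs_le (hf.pow_const 2) (K ^ 2) fun ω => by
      rw [abs_pow]; have := hK ω; gcongr
  set c := ∫ ω, |f ω| ∂P with hc
  have h0 : 0 ≤ ∫ ω, (f ω ^ 2 - 2 * c * |f ω| + c ^ 2) ∂P :=
    integral_nonneg fun ω => by
      change 0 ≤ f ω ^ 2 - 2 * c * |f ω| + c ^ 2
      rw [← sq_abs (f ω)]; nlinarith [sq_nonneg (|f ω| - c)]
  have i3 : Integrable (fun ω => f ω ^ 2 - 2 * c * |f ω|) P := i2.sub (i1.const_mul _)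
  rw [integral_add i3 (integrable_const _),
    integral_sub i2 (i1.const_mul _), integral_const_mul, ← hc] at h0
  simp at h0
  linarith

end AltReinforced

/-! ### Recursion for the characteristic functions and the central limit theorem. -/

namespace AltReinforced

variable {Ω : Type*} {mΩ : MeasurableSpace Ω}
variable {P : Measure Ω} {ℱ : Filtration ℕ mΩ} {γ δ C γ' δ' C' s₀ : ℝ} {x : ℕ → Ω → ℝ}

variable [IsProbabilityMeasure P]

/-- The characteristic function of the rescaled corrected sum. -/
noncomputable def correctedCharFun (P : Measure Ω) (δ : ℝ) (x : ℕ → Ω → ℝ) (n : ℕ) (s : ℝ) : ℂ :=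
  ∫ ω, Complex.exp (Complex.I * ((s * (correctedSum δ x n ω / √(n : ℝ)) : ℝ) : ℂ)) ∂P

-- Apply the one-step estimate at `θ = s / √(n + 1)`. One factor `|s|` is kept in the error and the
-- others are bounded by `1`; this weight makes the later induction contract.
open Topology in
theorem exists_norm_correctedCharFun_succ_sub_le (h : AltReinforced P ℱ γ δ C x)
    (hz : AltReinforced P ℱ γ' δ' C' (fun k ω => x k ω ^ 2 - s₀)) (hs : 0 ≤ s₀)
    (hγ : γ < 1) (hδ : δ < 1) (hγ' : γ' < 1) (hδ' : δ' < 1) :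
    ∃ e : ℕ → ℝ, Tendsto e atTop (𝓝 0) ∧ ∀ n ≥ 1, ∀ s : ℝ, |s| ≤ 1 →
      ‖correctedCharFun P δ x (n + 1) s - ((Real.exp (-(s ^ 2 * s₀ / (2 * (n + 1)))) : ℝ) : ℂ) *
        correctedCharFun P δ x n ((1 + γ / n) * (√(n : ℝ) / √((n : ℝ) + 1)) * s)‖ ≤
      |s| * (e n / n) := by
  have hC : 0 ≤ C := by
    obtain ⟨ω⟩ := P.nonempty_of_neZero
    exact h.bound_nonneg ω
  set z : ℕ → Ω → ℝ := fun k ω => x k ω ^ 2 - s₀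
  set M := (|γ| + |δ|) * C
  set K := C ^ 3 * Real.exp C + s₀ ^ 2 + s₀ * M
  set L : ℕ → ℝ := fun n => Real.exp M * ∫ ω, altDrift γ δ x n ω ^ 2 ∂P +
        ∫ ω, |altDrift γ' δ' z n ω| ∂P with hL
  have hL0 : ∀ n, 0 ≤ L n := fun n => add_nonneg
    (mul_nonneg (Real.exp_pos _).le (integral_nonneg fun ω => sq_nonneg _))
    (integral_nonneg fun ω => abs_nonneg _)
  have hL1 : Tendsto L atTop (𝓝 0) := by
    have h1 := (h.tendsto_integral_sq_altDrift hγ hδ).const_mul (Real.exp M)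
    have h2 : Tendsto (fun n => ∫ ω, |altDrift γ' δ' z n ω| ∂P) atTop (𝓝 0) := by
      refine squeeze_zero (fun n => integral_nonneg fun ω => abs_nonneg _)
        (fun n => integral_abs_le_sqrt (hz.measurable_altDrift n) (hz.abs_altDrift_le n)) ?_
      simpa using (hz.tendsto_integral_sq_altDrift hγ' hδ').sqrt
    simpa using h1.add h2
  have hsq : Tendsto (fun n : ℕ => √(n : ℝ)) atTop atTop :=
    Real.tendsto_sqrt_atTop.comp tendsto_natCast_atTop_atTop
  -- The terms over `√n` come from the two `O(1 / n)` replacement errors times `|θ|` and from the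
  -- cubic remainder; `L n` is the factor of `θ ^ 2`.
  refine ⟨fun n => (|δ| * C + |γ| * |δ| * C + K) / √(n : ℝ) + L n, ?_, fun n hn s hs1 => ?_⟩
  · simpa using (hsq.const_div_atTop (|δ| * C + |γ| * |δ| * C + K)).add hL1
  have hn1 : (1 : ℝ) ≤ n := by exact_mod_cast hn
  have hn0 : (0 : ℝ) < n := by linarith
  have hsn : 0 < √(n : ℝ) := Real.sqrt_pos.2 hn0
  have hsn1 : 0 < √((n : ℝ) + 1) := Real.sqrt_pos.2 (by linarith)
  have hle : √(n : ℝ) ≤ √((n : ℝ) + 1) := Real.sqrt_le_sqrt (by linarith)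
  have hsn2 : √(n : ℝ) ^ 2 = n := Real.sq_sqrt hn0.le
  set θ := s / √((n : ℝ) + 1) with hθ
  have hθs : |θ| ≤ |s| / √(n : ℝ) := by
    rw [hθ, abs_div, abs_of_pos hsn1]; gcongr
  have hθ1 : |θ| ≤ 1 := hθs.trans ((div_le_one hsn).2
    (hs1.trans (Real.one_le_sqrt.2 hn1)))
  have hmB := h.measurable_predictor' δ n
  have hmB' : Measurable (predictor δ x n) := hmB.mono (ℱ.le n) le_rfl
  have hx := h.measurable (show 1 ≤ n + 1 by omega)
  have hm := h.measurable_altDrift n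
  have step := h.norm_integral_cexp_step_le hz hs hn hmB hθ1
  have hθ2 : θ ^ 2 * s₀ / 2 = s ^ 2 * s₀ / (2 * (n + 1)) := by
    rw [hθ, div_pow, Real.sq_sqrt (by linarith)]; field_simp
  rw [hθ2] at step
  set g := Real.exp (-(s ^ 2 * s₀ / (2 * (n + 1))))
  have hg : ‖(g : ℂ)‖ ≤ 1 := by
    rw [Complex.norm_real, Real.norm_eq_abs, abs_of_pos (Real.exp_pos _)]
    exact Real.exp_le_one_iff.2 (neg_nonpos.2 (by positivity))
  have d1 : ‖correctedCharFun P δ x (n + 1) s -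
      ∫ ω, Complex.exp (Complex.I * ((θ * (predictor δ x n ω + x (n + 1) ω) : ℝ) : ℂ)) ∂P‖ ≤
      |θ| * (|δ| * C / n) := by
    refine norm_integral_cexp_I_mul_sub_le
      (((h.measurable_correctedSum δ (n + 1)).div_const _).const_mul s)
      ((hmB'.add hx).const_mul θ) fun ω => ?_
    have h1 := h.abs_correctedSum_succ_sub_le δ hn ω
    have h2 : s * (correctedSum δ x (n + 1) ω / √((n + 1 : ℕ) : ℝ)) -
        θ * (predictor δ x n ω + x (n + 1) ω) =
        θ * (correctedSum δ x (n + 1) ω - (predictor δ x n ω + x (n + 1) ω)) := by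
      rw [hθ]; push_cast; ring
    rw [Pi.add_apply, h2, abs_mul]
    gcongr
  have d3 : ‖∫ ω, Complex.exp (Complex.I *
      ((θ * (predictor δ x n ω + altDrift γ δ x n ω) : ℝ) : ℂ)) ∂P -
      correctedCharFun P δ x n ((1 + γ / n) * (√(n : ℝ) / √((n : ℝ) + 1)) * s)‖ ≤
      |θ| * (|γ| * |δ| * C / n) := by
    refine norm_integral_cexp_I_mul_sub_le ((hmB'.add hm).const_mul θ)
      (((h.measurable_correctedSum δ n).div_const _).const_mul _) fun ω => ?_
    have h1 := h.abs_predictor_add_altDrift_sub_le hn ω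
    have h2 : θ * (predictor δ x n ω + altDrift γ δ x n ω) -
        (1 + γ / n) * (√(n : ℝ) / √((n : ℝ) + 1)) * s * (correctedSum δ x n ω / √(n : ℝ)) =
        θ * (predictor δ x n ω + altDrift γ δ x n ω - (1 + γ / n) * correctedSum δ x n ω) := by
      rw [hθ]; field_simp
    rw [Pi.add_apply, h2, abs_mul]
    gcongr
  set I₁ := ∫ ω, Complex.exp (Complex.I * ((θ * (predictor δ x n ω + x (n + 1) ω) : ℝ) : ℂ)) ∂P
  set I₂ := ∫ ω, Complex.exp (Complex.I *
      ((θ * (predictor δ x n ω + altDrift γ δ x n ω) : ℝ) : ℂ)) ∂P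
  set φ := correctedCharFun P δ x n ((1 + γ / n) * (√(n : ℝ) / √((n : ℝ) + 1)) * s)
  have d3' : ‖(g : ℂ) * (I₂ - φ)‖ ≤ |θ| * (|γ| * |δ| * C / n) := by
    rw [norm_mul]
    exact (mul_le_of_le_one_left (norm_nonneg _) hg).trans d3
  have hs0 := abs_nonneg s
  have b3 : |θ| ^ 3 ≤ |s| * (1 / √(n : ℝ) / n) := by
    calc |θ| ^ 3 ≤ (|s| / √(n : ℝ)) ^ 3 := by gcongr
      _ = |s| ^ 3 * (1 / √(n : ℝ) / √(n : ℝ) ^ 2) := by field_simp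
      _ ≤ |s| * (1 / √(n : ℝ) / n) := by
        rw [hsn2]; gcongr
        calc |s| ^ 3 = |s| * |s| ^ 2 := by ring
          _ ≤ |s| * 1 := by gcongr; exact pow_le_one₀ hs0 hs1
          _ = |s| := mul_one _
  have b2 : θ ^ 2 ≤ |s| * (1 / n) := by
    rw [← sq_abs]
    calc |θ| ^ 2 ≤ (|s| / √(n : ℝ)) ^ 2 := by gcongr
      _ = |s| ^ 2 * (1 / n) := by rw [div_pow, hsn2]; ring
      _ ≤ |s| * (1 / n) := by
        gcongr
        calc |s| ^ 2 = |s| * |s| := by ring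
          _ ≤ |s| * 1 := by gcongr
          _ = |s| := mul_one _
  have b1 : |θ| ≤ |s| * (1 / √(n : ℝ)) := hθs.trans_eq (by ring)
  have hK : 0 ≤ K := by
    have : 0 ≤ M := by positivity
    positivity
  calc ‖correctedCharFun P δ x (n + 1) s - g * φ‖
      = ‖(correctedCharFun P δ x (n + 1) s - I₁) + (I₁ - g * I₂) + g * (I₂ - φ)‖ := by
        congr 1; ring
    _ ≤ |θ| * (|δ| * C / n) + (|θ| ^ 3 * K + θ ^ 2 * L n) + |θ| * (|γ| * |δ| * C / n) :=
        norm_add₃_le.trans (add_le_add (add_le_add d1 step) d3')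
    _ ≤ |s| * (1 / √(n : ℝ)) * (|δ| * C / n) +
        (|s| * (1 / √(n : ℝ) / n) * K + |s| * (1 / n) * L n) +
        |s| * (1 / √(n : ℝ)) * (|γ| * |δ| * C / n) := by
        have := hL0 n
        gcongr
    _ = _ := by ring

/-- The Gaussian profile is almost invariant under the recursion of the characteristic functions. -/
theorem abs_exp_gaussian_step_le (hγ : γ < 1 / 2) (hs : 0 ≤ s₀) {n : ℕ} (hn : 1 ≤ n) {s : ℝ}
    (hs1 : |s| ≤ 1) :
    |Real.exp (-(s ^ 2 * s₀ / (2 * (n + 1)))) *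
        Real.exp (-(s₀ / (2 * (1 - 2 * γ)) * ((1 + γ / n) * (√(n : ℝ) / √((n : ℝ) + 1)) * s) ^ 2)) -
      Real.exp (-(s₀ / (2 * (1 - 2 * γ)) * s ^ 2))| ≤
    |s| * (s₀ / (2 * (1 - 2 * γ)) * γ ^ 2 / n / n) := by
  have hn1 : (1 : ℝ) ≤ n := by exact_mod_cast hn
  have hg : 0 < 1 - 2 * γ := by linarith
  have hv : 0 ≤ s₀ / (2 * (1 - 2 * γ)) := by positivity
  rw [← Real.exp_add, ← neg_add]
  refine (abs_exp_neg_sub_exp_neg_le (by positivity) (by positivity)).trans ?_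
  -- The value `s₀ / (2 * (1 - 2 * γ))` is the one for which the terms of order `1 / n` cancel.
  have e : s ^ 2 * s₀ / (2 * (n + 1)) +
      s₀ / (2 * (1 - 2 * γ)) * ((1 + γ / n) * (√(n : ℝ) / √((n : ℝ) + 1)) * s) ^ 2 -
      s₀ / (2 * (1 - 2 * γ)) * s ^ 2 = s ^ 2 * (s₀ / (2 * (1 - 2 * γ)) * γ ^ 2 / n / (n + 1)) := by
    rw [mul_pow, mul_pow, div_pow, Real.sq_sqrt (by linarith), Real.sq_sqrt (by linarith)]
    field_simp
    ring
  rw [e, abs_of_nonneg (by positivity)]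
  have hs2 : s ^ 2 ≤ |s| := by
    rw [← sq_abs]; nlinarith [abs_nonneg s]
  gcongr
  linarith

theorem norm_correctedCharFun_sub_one_le (h : AltReinforced P ℱ γ δ C x) {n : ℕ} (hn : 1 ≤ n)
    (s : ℝ) : ‖correctedCharFun P δ x n s - 1‖ ≤ |s| * (n * (C * (1 + |δ|))) := by
  have hn1 : (1 : ℝ) ≤ n := by exact_mod_cast hn
  have h1 := norm_integral_cexp_I_mul_sub_le (P := P)
    (((h.measurable_correctedSum δ n).div_const √(n : ℝ)).const_mul s)
    (measurable_const (a := (0 : ℝ))) (K := |s| * (n * (C * (1 + |δ|)))) fun ω => by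
      rw [sub_zero, abs_mul, abs_div, abs_of_nonneg (Real.sqrt_nonneg _)]
      gcongr
      exact (div_le_self (abs_nonneg _) (Real.one_le_sqrt.2 hn1)).trans
        (h.abs_correctedSum_le δ hn ω)
  simpa [correctedCharFun] using h1

open Topology in
/-- Central limit theorem for alternating reinforced sums. -/
theorem tendsto_integral_cexp_stepSum (h : AltReinforced P ℱ γ δ C x)
    (hz : AltReinforced P ℱ γ' δ' C' (fun k ω => x k ω ^ 2 - s₀)) (hs : 0 ≤ s₀)
    (hγ : γ < 1 / 2) (hδ : δ < 1) (hγ' : γ' < 1) (hδ' : δ' < 1) :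
    Tendsto (fun n : ℕ => ∫ ω, Complex.exp (Complex.I * ((stepSum x n ω / √(n : ℝ) : ℝ) : ℂ)) ∂P)
      atTop (𝓝 ((Real.exp (-(s₀ / (2 * (1 - 2 * γ)))) : ℝ) : ℂ)) := by
  obtain ⟨e, he0, he⟩ := h.exists_norm_correctedCharFun_succ_sub_le hz hs (by linarith) hδ hγ' hδ'
  set v := s₀ / (2 * (1 - 2 * γ)) with hv
  have hv0 : 0 ≤ v := div_nonneg hs (by linarith)
  set ρ : ℕ → ℝ := fun n => (1 + γ / n) * (√(n : ℝ) / √((n : ℝ) + 1)) with hρ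
  set e' : ℕ → ℝ := fun n => |e n| + v * γ ^ 2 / n with he'
  have he'0 : Tendsto e' atTop (𝓝 0) := by
    simpa using he0.abs.add (tendsto_const_div_atTop_nhds_zero_nat (v * γ ^ 2))
  obtain ⟨N, hN⟩ := eventually_atTop.1
    ((eventually_abs_mul_sqrt_div_sqrt_le hγ).and (eventually_ge_atTop 1))
  have hN1 : 1 ≤ N := (hN N le_rfl).2
  have hC : 0 ≤ C := by
    obtain ⟨ω⟩ := P.nonempty_of_neZero
    exact h.bound_nonneg ω
  -- Error bound at time `N + k`. The initial value adds crude Lipschitz constants of the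
  -- characteristic function and of the Gaussian profile, both of which equal `1` at `s = 0`.
  let w : ℕ → ℝ := fun k => Nat.rec (N * (C * (1 + |δ|)) + v)
    (fun k a => |ρ (N + k)| * a + e' (N + k) / ((N + k : ℕ) : ℝ)) k
  have hw0 : w 0 = N * (C * (1 + |δ|)) + v := rfl
  have hws : ∀ k, w (k + 1) = |ρ (N + k)| * w k + e' (N + k) / ((N + k : ℕ) : ℝ) := fun k => rfl
  have he'p : ∀ n, 0 ≤ e' n := fun n => by positivity
  have hwp : ∀ k, 0 ≤ w k := by
    intro k
    induction k with
    | zero => rw [hw0]; positivity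
    | succ k ih => rw [hws]; have := he'p (N + k); positivity
  have hwlim : Tendsto (fun n => w (n - N)) atTop (𝓝 0) := by
    refine tendsto_zero_of_contraction (c := (1 - 2 * γ) / 8) (by linarith) (fun n => hwp _) he'0 ?_
    filter_upwards [eventually_ge_atTop N] with n hn
    have h1 : n + 1 - N = (n - N) + 1 := by omega
    have h2 : N + (n - N) = n := by omega
    rw [h1, hws, h2]
    have := (hN n hn).1
    have := hwp (n - N)
    gcongr
  -- The interval `|s| ≤ 1` is preserved by `s ↦ ρ n * s`, and the weight `|s|` returns the factor
  -- `|ρ n|`; the Gaussian factor `g` is bounded by `1` and could not give a uniform contraction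
  -- near `s = 0`.
  have main : ∀ k, ∀ s : ℝ, |s| ≤ 1 →
      ‖correctedCharFun P δ x (N + k) s - ((Real.exp (-(v * s ^ 2)) : ℝ) : ℂ)‖ ≤ |s| * w k := by
    intro k
    induction k with
    | zero =>
      intro s hs1
      rw [hw0, add_zero, mul_add]
      have h1 := h.norm_correctedCharFun_sub_one_le hN1 s
      have h2 : ‖(1 : ℂ) - ((Real.exp (-(v * s ^ 2)) : ℝ) : ℂ)‖ ≤ |s| * v := by
        rw [← Complex.ofReal_one, ← Complex.ofReal_sub, Complex.norm_real, Real.norm_eq_abs]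
        have h3 := abs_exp_neg_sub_exp_neg_le le_rfl (show 0 ≤ v * s ^ 2 by positivity)
        rw [neg_zero, Real.exp_zero, zero_sub, abs_neg,
          abs_of_nonneg (show 0 ≤ v * s ^ 2 by positivity)] at h3
        refine h3.trans ?_
        rw [mul_comm]
        gcongr
        rw [← sq_abs]; nlinarith [abs_nonneg s]
      exact (norm_sub_le_norm_sub_add_norm_sub _ _ _).trans (add_le_add h1 h2)
    | succ k ih =>
      intro s hs1
      obtain ⟨hr, hn⟩ := hN (N + k) (by omega)
      set n := N + k
      have hn0 : (0 : ℝ) < n := by exact_mod_cast hn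
      have hr1 : |ρ n| ≤ 1 := hr.trans (sub_le_self _ (div_nonneg (by linarith) hn0.le))
      have hrs : |ρ n * s| ≤ 1 := by rw [abs_mul]; exact mul_le_one₀ hr1 (abs_nonneg _) hs1
      have a1 := he n hn s hs1
      have a2 := ih (ρ n * s) hrs
      have a3 := abs_exp_gaussian_step_le hγ hs hn hs1
      rw [← hv] at a3
      change |_ * Real.exp (-(v * (ρ n * s) ^ 2)) - _| ≤ _ at a3
      change ‖_ - _ * correctedCharFun P δ x n (ρ n * s)‖ ≤ _ at a1
      set g := Real.exp (-(s ^ 2 * s₀ / (2 * (n + 1))))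
      have hg : ‖(g : ℂ)‖ ≤ 1 := by
        rw [Complex.norm_real, Real.norm_eq_abs, abs_of_pos (Real.exp_pos _)]
        exact Real.exp_le_one_iff.2 (neg_nonpos.2 (by positivity))
      have a2' : ‖(g : ℂ) * (correctedCharFun P δ x n (ρ n * s) -
          ((Real.exp (-(v * (ρ n * s) ^ 2)) : ℝ) : ℂ))‖ ≤ |ρ n * s| * w k := by
        rw [norm_mul]; exact (mul_le_of_le_one_left (norm_nonneg _) hg).trans a2
      have a3' : ‖((g * Real.exp (-(v * (ρ n * s) ^ 2)) - Real.exp (-(v * s ^ 2)) : ℝ) : ℂ)‖ ≤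
          |s| * (v * γ ^ 2 / n / n) := by
        rw [Complex.norm_real]; exact a3
      have split : correctedCharFun P δ x (N + (k + 1)) s - ((Real.exp (-(v * s ^ 2)) : ℝ) : ℂ) =
          (correctedCharFun P δ x (n + 1) s - g * correctedCharFun P δ x n (ρ n * s)) +
          (g : ℂ) * (correctedCharFun P δ x n (ρ n * s) -
            ((Real.exp (-(v * (ρ n * s) ^ 2)) : ℝ) : ℂ)) +
          ((g * Real.exp (-(v * (ρ n * s) ^ 2)) - Real.exp (-(v * s ^ 2)) : ℝ) : ℂ) := by
        rw [← add_assoc N k 1]; push_cast; ring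
      rw [split, hws]
      refine norm_add₃_le.trans ((add_le_add (add_le_add a1 a2') a3').trans ?_)
      have : |s| * (e n / n) ≤ |s| * (|e n| / n) := by gcongr; exact le_abs_self _
      calc _ ≤ |s| * (|e n| / n) + |ρ n * s| * w k + |s| * (v * γ ^ 2 / n / n) := by gcongr
        _ = |s| * (|ρ n| * w k + e' n / n) := by rw [abs_mul]; simp only [he']; ring
  rw [tendsto_iff_norm_sub_tendsto_zero]
  have hsq : Tendsto (fun n : ℕ => √(n : ℝ)) atTop atTop :=
    Real.tendsto_sqrt_atTop.comp tendsto_natCast_atTop_atTop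
  have hlim := (hsq.const_div_atTop (|δ| / 2 * C)).add hwlim
  rw [add_zero] at hlim
  refine squeeze_zero' (.of_forall fun n => norm_nonneg _) ?_ hlim
  filter_upwards [eventually_ge_atTop N] with n hn
  -- Only `s = 1` is needed: the frequency can be absorbed into the sequence `x`.
  have m1 := main (n - N) 1 (by simp)
  rw [show N + (n - N) = n by omega] at m1
  simp only [one_pow, mul_one, abs_one, one_mul] at m1
  have m2 : ‖∫ ω, Complex.exp (Complex.I * ((stepSum x n ω / √(n : ℝ) : ℝ) : ℂ)) ∂P -
      correctedCharFun P δ x n 1‖ ≤ |δ| / 2 * C / √(n : ℝ) := by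
    refine norm_integral_cexp_I_mul_sub_le ((h.measurable_stepSum n).div_const _)
      (((h.measurable_correctedSum δ n).div_const _).const_mul 1) fun ω => ?_
    rw [one_mul, ← sub_div, abs_div, abs_of_nonneg (Real.sqrt_nonneg _), abs_sub_comm]
    gcongr
    exact h.abs_correctedSum_sub_le δ n ω
  exact (norm_sub_le_norm_sub_add_norm_sub _ _ _).trans (add_le_add m2 m1)

end AltReinforced

/-! ### The step kernel and an adapted version of the walk. -/

/-- If the point masses on a finite set sum to one, the variable lies in that set a.s. -/
theorem ae_mem_finset_of_sum_measureReal_eq_one {Ω β : Type*} [MeasurableSpace Ω]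
    [MeasurableSpace β] [MeasurableSingletonClass β] {P : Measure Ω} [IsProbabilityMeasure P]
    {Y : Ω → β} (hY : Measurable Y) (s : Finset β)
    (hs : ∑ w ∈ s, P.real {ω | Y ω = w} = 1) : ∀ᵐ ω ∂P, Y ω ∈ s := by
  have h1 : ∑ w ∈ s, P.real (Y ⁻¹' {w}) = P.real (Y ⁻¹' s) :=
    sum_measureReal_preimage_singleton s fun w _ => hY (measurableSet_singleton w)
  have h2 : P.real (Y ⁻¹' s) = 1 := h1.symm.trans hs
  have h3 : P (Y ⁻¹' s) = 1 := by
    rw [measureReal_def] at h2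
    exact (ENNReal.toReal_eq_one_iff _).1 h2
  exact (mem_ae_iff_prob_eq_one (hY s.measurableSet)).2 h3

namespace ERWSetting

variable {d : ℕ} (𝓢 : ERWSetting d)

theorem neg_mem_Vodd_iff {v : EuclideanSpace ℝ (Fin d)} : -v ∈ 𝓢.Vodd ↔ v ∈ 𝓢.Veven := by
  rw [𝓢.mem_Vodd_iff, neg_neg]

theorem two_le_m : (2 : ℝ) ≤ 𝓢.m := by exact_mod_cast 𝓢.two_le_card

theorem dirs_of_odd {k : ℕ} (hk : Odd k) : 𝓢.dirs k = 𝓢.Vodd := if_pos hk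

theorem dirs_of_even {k : ℕ} (hk : Even k) : 𝓢.dirs k = 𝓢.Veven :=
  if_neg (Nat.not_odd_iff_even.2 hk)

theorem mem_V_of_mem_dirs {k : ℕ} {v : EuclideanSpace ℝ (Fin d)} (hv : v ∈ 𝓢.dirs k) :
    v ∈ 𝓢.V := by
  rcases Nat.even_or_odd k with hk | hk
  · rw [dirs_of_even _ hk] at hv; exact Or.inr hv
  · rw [dirs_of_odd _ hk] at hv; exact Or.inl hv

/-- The reflection taking the directions at time `k` to `V_odd`. -/
theorem sign_smul_mem_Vodd_iff {k : ℕ} {v : EuclideanSpace ℝ (Fin d)} :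
    (-1 : ℝ) ^ (k + 1) • v ∈ 𝓢.Vodd ↔ v ∈ 𝓢.dirs k := by
  rcases Nat.even_or_odd k with hk | hk
  · rw [dirs_of_even _ hk, hk.add_one.neg_one_pow, neg_smul, one_smul, neg_mem_Vodd_iff]
  · rw [dirs_of_odd _ hk, hk.add_one.neg_one_pow, one_smul]

theorem neg_mem_dirs_of_notMem {k : ℕ} {v : EuclideanSpace ℝ (Fin d)} (hv : v ∈ 𝓢.V)
    (hk : v ∉ 𝓢.dirs k) : -v ∈ 𝓢.dirs k := by
  rcases Nat.even_or_odd k with h | h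
  · rw [dirs_of_even _ h] at hk ⊢
    rcases hv with hv | hv
    · exact (𝓢.mem_Vodd_iff v).1 hv
    · exact absurd hv hk
  · rw [dirs_of_odd _ h] at hk ⊢
    rcases hv with hv | hv
    · exact absurd hv hk
    · exact 𝓢.neg_mem_Vodd_iff.2 hv

theorem sum_dirs_eq_sum_Vodd (k : ℕ) (f : EuclideanSpace ℝ (Fin d) → ℝ) :
    ∑ w ∈ 𝓢.dirs k, f ((-1 : ℝ) ^ (k + 1) • w) = ∑ w ∈ 𝓢.Vodd, f w := by
  have hsq : ∀ w : EuclideanSpace ℝ (Fin d), (-1 : ℝ) ^ (k + 1) • (-1 : ℝ) ^ (k + 1) • w = w := by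
    intro w; rw [smul_smul, ← mul_pow]; simp
  refine Finset.sum_nbij' (fun w => (-1 : ℝ) ^ (k + 1) • w) (fun w => (-1 : ℝ) ^ (k + 1) • w)
    (fun w hw => 𝓢.sign_smul_mem_Vodd_iff.2 hw) (fun w hw => ?_) (fun w _ => hsq w)
    (fun w _ => hsq w) (fun w _ => rfl)
  rw [← 𝓢.sign_smul_mem_Vodd_iff, hsq]; exact hw

theorem card_dirs (k : ℕ) : (𝓢.dirs k).card = 𝓢.m := by
  have h := 𝓢.sum_dirs_eq_sum_Vodd k fun _ => 1
  simp only [Finset.sum_const, nsmul_eq_mul, mul_one] at h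
  exact_mod_cast h

theorem dirs_nonempty (k : ℕ) : (𝓢.dirs k).Nonempty := by
  rw [← Finset.card_pos, card_dirs]; exact lt_of_lt_of_le two_pos 𝓢.two_le_card

-- The kernel is a constant plus an atom at the favoured direction, of weight `p - (1 - p) / (m - 1)
-- = α`, respectively `β`.
open Classical in
theorem sum_stepProb_mul (p q : ℝ) (k : ℕ) {v : EuclideanSpace ℝ (Fin d)} (hv : v ∈ 𝓢.V)
    (F : EuclideanSpace ℝ (Fin d) → ℝ) :
    ∑ w ∈ 𝓢.dirs k, 𝓢.stepProb p q k v w * F w =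
      if v ∈ 𝓢.dirs k then
        (1 - p) / ((𝓢.m : ℝ) - 1) * ∑ w ∈ 𝓢.dirs k, F w + 𝓢.α p * F v
      else
        (1 - q) / ((𝓢.m : ℝ) - 1) * ∑ w ∈ 𝓢.dirs k, F w + 𝓢.β q * F (-v) := by
  have hm := 𝓢.two_le_m
  have hm1 : (𝓢.m : ℝ) - 1 ≠ 0 := by linarith
  have key : ∀ (r : ℝ) (u : EuclideanSpace ℝ (Fin d)), u ∈ 𝓢.dirs k →
      ∑ w ∈ 𝓢.dirs k, (if u = w then r else (1 - r) / ((𝓢.m : ℝ) - 1)) * F w =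
      (1 - r) / ((𝓢.m : ℝ) - 1) * ∑ w ∈ 𝓢.dirs k, F w +
        ((𝓢.m : ℝ) * r - 1) / ((𝓢.m : ℝ) - 1) * F u := by
    intro r u hu
    have h1 : ∀ w ∈ 𝓢.dirs k, (if u = w then r else (1 - r) / ((𝓢.m : ℝ) - 1)) * F w =
        (1 - r) / ((𝓢.m : ℝ) - 1) * F w +
          if u = w then ((𝓢.m : ℝ) * r - 1) / ((𝓢.m : ℝ) - 1) * F w else 0 := by
      intro w _
      split_ifs
      · field_simp; ring
      · simp
    rw [Finset.sum_congr rfl h1, Finset.sum_add_distrib, ← Finset.mul_sum, Finset.sum_ite_eq,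
      if_pos hu]
  by_cases hvk : v ∈ 𝓢.dirs k
  · simp only [stepProb, if_pos hvk]
    exact key p v hvk
  · simp only [stepProb, if_neg hvk]
    exact key q (-v) (𝓢.neg_mem_dirs_of_notMem hv hvk)

theorem sum_stepProb (p q : ℝ) (k : ℕ) {v : EuclideanSpace ℝ (Fin d)} (hv : v ∈ 𝓢.V) :
    ∑ w ∈ 𝓢.dirs k, 𝓢.stepProb p q k v w = 1 := by
  have h := 𝓢.sum_stepProb_mul p q k hv fun _ => 1
  have hm := 𝓢.two_le_m
  have hm1 : (𝓢.m : ℝ) - 1 ≠ 0 := by linarith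
  simp only [mul_one, Finset.sum_const, card_dirs, nsmul_eq_mul] at h
  rw [h]
  split_ifs <;> simp only [α, β] <;> field_simp <;> ring

/-- For centred functions, one step acts as multiplication by `γ ± δ`, up to reflection. -/
theorem sum_stepProb_mul_of_sum_eq_zero (p q : ℝ) {n j : ℕ}
    {v : EuclideanSpace ℝ (Fin d)} (hv : v ∈ 𝓢.dirs j) {f : EuclideanSpace ℝ (Fin d) → ℝ}
    (hf : ∑ w ∈ 𝓢.Vodd, f w = 0) :
    ∑ w ∈ 𝓢.dirs n, 𝓢.stepProb p q n v w * f ((-1 : ℝ) ^ (n + 1) • w) =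
      (𝓢.γ p q + (-1) ^ n * (-1) ^ j * 𝓢.δ p q) * f ((-1 : ℝ) ^ (j + 1) • v) := by
  classical
  rw [sum_stepProb_mul _ _ _ _ (𝓢.mem_V_of_mem_dirs hv), sum_dirs_eq_sum_Vodd, hf]
  have hdisj : ∀ w, w ∈ 𝓢.Vodd → w ∉ 𝓢.Veven := fun w hw =>
    Finset.disjoint_left.1 𝓢.disjoint_steps hw
  simp only [γ, δ]
  -- By disjointness of the step sets, parity decides the branch: equal parities give `α = γ + δ`,
  -- opposite ones `β = γ - δ`. In the latter case the negation in the kernel is undone by the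
  -- reflection.
  rcases Nat.even_or_odd n with hn | hn <;> rcases Nat.even_or_odd j with hj | hj
  · rw [dirs_of_even _ hj] at hv
    rw [dirs_of_even _ hn, if_pos hv]
    simp only [pow_succ, hn.neg_one_pow, hj.neg_one_pow]; ring
  · rw [dirs_of_odd _ hj] at hv
    rw [dirs_of_even _ hn, if_neg (hdisj v hv)]
    simp only [pow_succ, hn.neg_one_pow, hj.neg_one_pow, one_mul, neg_smul, one_smul, neg_neg,
      neg_mul_neg]
    ring
  · rw [dirs_of_even _ hj] at hv
    rw [dirs_of_odd _ hn, if_neg fun h => hdisj v h hv]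
    simp only [pow_succ, hn.neg_one_pow, hj.neg_one_pow, one_mul, neg_smul, one_smul,
      neg_mul_neg]
    ring
  · rw [dirs_of_odd _ hj] at hv
    rw [dirs_of_odd _ hn, if_pos hv]
    simp only [pow_succ, hn.neg_one_pow, hj.neg_one_pow]; ring

variable {Ω : Type*} {mΩ : MeasurableSpace Ω} {P : Measure Ω} {p q : ℝ}
  {X : ℕ → Ω → EuclideanSpace ℝ (Fin d)} {U : ℕ → Ω → ℕ}
  {G : ℕ → EuclideanSpace ℝ (Fin d) → Ω → EuclideanSpace ℝ (Fin d)}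

namespace IsERW

variable {𝓢}

theorem innovation_le (h : 𝓢.IsERW P p q X U G) (n : ℕ) : 𝓢.innovation X U G n ≤ mΩ := by
  unfold innovation
  split_ifs with hn
  · exact h.measurable_first.comap_le
  · refine sup_le (h.measurable_memory n (by omega)).comap_le (iSup₂_le fun v hv => ?_)
    exact (h.measurable_choice (n + 1) (by omega) v hv).comap_le

/-- The σ-algebra generated by the first `n` innovations. -/
def past (h : 𝓢.IsERW P p q X U G) : Filtration ℕ mΩ where
  seq n := ⨆ k ∈ Set.Iio n, 𝓢.innovation X U G k
  mono' _ _ hmn := biSup_mono fun _ hk => lt_of_lt_of_le hk hmn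
  le' _ := iSup₂_le fun k _ => h.innovation_le k

theorem innovation_le_past (h : 𝓢.IsERW P p q X U G) {k n : ℕ} (hk : k < n) :
    𝓢.innovation X U G k ≤ h.past n :=
  le_iSup₂_of_le (f := fun k (_ : k ∈ Set.Iio n) => 𝓢.innovation X U G k) k hk le_rfl

theorem indep_past_innovation (h : 𝓢.IsERW P p q X U G) (n : ℕ) :
    Indep (h.past n) (𝓢.innovation X U G n) P := by
  have h1 := indep_iSup_of_disjoint h.innovation_le h.indep_steps
    (S := Set.Iio n) (T := {n}) (by simp)
  rw [iSup_singleton] at h1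
  exact h1

theorem measurable_first' (h : 𝓢.IsERW P p q X U G) : Measurable[h.past 1] (X 1) := by
  refine Measurable.mono (comap_measurable (X 1)) ?_ le_rfl
  have := h.innovation_le_past (show 0 < 1 by omega)
  simpa [innovation] using this

theorem measurable_memory_innovation (𝓢 : ERWSetting d) {n : ℕ} (hn : 1 ≤ n) :
    Measurable[𝓢.innovation X U G n] (U n) := by
  refine Measurable.mono (comap_measurable (U n)) ?_ le_rfl
  rw [innovation, if_neg (by omega)]
  exact le_sup_left

theorem measurable_choice_innovation (𝓢 : ERWSetting d) {n : ℕ} (hn : 1 ≤ n)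
    {v : EuclideanSpace ℝ (Fin d)} (hv : v ∈ 𝓢.V) :
    Measurable[𝓢.innovation X U G n] (G (n + 1) v) := by
  refine Measurable.mono (comap_measurable (G (n + 1) v)) ?_ le_rfl
  rw [innovation, if_neg (by omega)]
  exact le_sup_of_le_right (le_iSup₂_of_le (f := fun v (_ : v ∈ 𝓢.V) =>
    MeasurableSpace.comap (G (n + 1) v) inferInstance) v hv le_rfl)

variable [IsProbabilityMeasure P]

theorem ae_first_mem (h : 𝓢.IsERW P p q X U G) : ∀ᵐ ω ∂P, X 1 ω ∈ 𝓢.dirs 1 := by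
  have hm := 𝓢.two_le_m
  rw [dirs_of_odd _ odd_one]
  refine ae_mem_finset_of_sum_measureReal_eq_one h.measurable_first _ ?_
  rw [Finset.sum_congr rfl h.law_first, Finset.sum_const, nsmul_eq_mul, mul_one_div]
  exact div_self (by change (𝓢.m : ℝ) ≠ 0; linarith)

theorem ae_memory_mem (h : 𝓢.IsERW P p q X U G) {n : ℕ} (hn : 1 ≤ n) :
    ∀ᵐ ω ∂P, U n ω ∈ Finset.Icc 1 n := by
  refine ae_mem_finset_of_sum_measureReal_eq_one (h.measurable_memory n hn) _ ?_
  rw [Finset.sum_congr rfl (h.law_memory n hn), Finset.sum_const, nsmul_eq_mul, mul_one_div]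
  rw [Nat.card_Icc, Nat.add_sub_cancel]
  exact div_self (by positivity)

theorem ae_choice_mem (h : 𝓢.IsERW P p q X U G) {k : ℕ} (hk : 2 ≤ k) :
    ∀ᵐ ω ∂P, ∀ v ∈ 𝓢.V, G k v ω ∈ 𝓢.dirs k := by
  classical
  have h1 : ∀ v ∈ 𝓢.V, ∀ᵐ ω ∂P, G k v ω ∈ 𝓢.dirs k := fun v hv => by
    refine ae_mem_finset_of_sum_measureReal_eq_one (h.measurable_choice k hk v hv) _ ?_
    rw [Finset.sum_congr rfl (h.law_choice k hk v hv), sum_stepProb _ _ _ _ hv]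
  have hV : 𝓢.V.Countable := by
    refine ((𝓢.Vodd ∪ 𝓢.Veven).finite_toSet.subset fun v hv => ?_).countable
    simpa [V] using hv
  exact (ae_ball_iff hV).2 h1

/-- The step equation holds only almost surely, so the later `X n` need be neither measurable nor
adapted. Unrolling the recursion gives a version built from the first `n` innovations, with values
in the right directions everywhere. -/
theorem exists_adapted_modification (h : 𝓢.IsERW P p q X U G) (n : ℕ) (hn : 1 ≤ n) :
    ∃ Z : Ω → EuclideanSpace ℝ (Fin d), Measurable[h.past n] Z ∧ (∀ ω, Z ω ∈ 𝓢.dirs n) ∧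
      X n =ᵐ[P] Z := by
  classical
  suffices hs : ∃ Z : Ω → EuclideanSpace ℝ (Fin d), Measurable[h.past n] Z ∧
      ∀ᵐ ω ∂P, X n ω = Z ω ∧ Z ω ∈ 𝓢.dirs n by
    obtain ⟨Z, hZ, hXZ⟩ := hs
    obtain ⟨w₀, hw₀⟩ := 𝓢.dirs_nonempty n
    refine ⟨fun ω => if Z ω ∈ 𝓢.dirs n then Z ω else w₀, ?_, fun ω => ?_, ?_⟩
    · exact Measurable.ite (hZ (𝓢.dirs n).measurableSet) hZ measurable_const
    · dsimp only; split_ifs with hω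
      exacts [hω, hw₀]
    · filter_upwards [hXZ] with ω hω
      rw [if_pos hω.2, hω.1]
  induction n using Nat.strong_induction_on with
  | _ n ih =>
  rcases Nat.lt_or_ge 1 n with h1 | h1
  swap
  · obtain rfl : n = 1 := by omega
    exact ⟨X 1, h.measurable_first', h.ae_first_mem.mono fun ω hω => ⟨rfl, hω⟩⟩
  obtain ⟨n, rfl⟩ : ∃ k, n = k + 1 := ⟨n - 1, by omega⟩
  have hn1 : 1 ≤ n := by omega
  have ih' : ∀ j, ∃ Z : Ω → EuclideanSpace ℝ (Fin d), j ∈ Finset.Icc 1 n → Measurable[h.past j] Z ∧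
      ∀ᵐ ω ∂P, X j ω = Z ω ∧ Z ω ∈ 𝓢.dirs j := by
    intro j
    by_cases hj : j ∈ Finset.Icc 1 n
    · have hj' := Finset.mem_Icc.1 hj
      obtain ⟨Z, hZ⟩ := ih j (by omega) hj'.1
      exact ⟨Z, fun _ => hZ⟩
    · exact ⟨X 0, fun hj' => absurd hj' hj⟩
  choose Z hZ using ih'
  -- Splitting by memory time and remembered value evaluates `G (n + 1)` only at fixed directions,
  -- where it is measurable.
  refine ⟨fun ω => ∑ j ∈ Finset.Icc 1 n, ∑ v ∈ 𝓢.dirs j,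
    if U n ω = j ∧ Z j ω = v then G (n + 1) v ω else 0, ?_, ?_⟩
  · refine Finset.measurable_fun_sum _ fun j hj => Finset.measurable_fun_sum _ fun v hv => ?_
    have mU : Measurable[h.past (n + 1)] (U n) :=
      (measurable_memory_innovation 𝓢 hn1).mono (h.innovation_le_past (by omega)) le_rfl
    have mG : Measurable[h.past (n + 1)] (G (n + 1) v) :=
      (measurable_choice_innovation 𝓢 hn1 (𝓢.mem_V_of_mem_dirs hv)).mono
        (h.innovation_le_past (by omega)) le_rfl
    have mZ : Measurable[h.past (n + 1)] (Z j) :=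
      (hZ j hj).1.mono (h.past.mono (by have := Finset.mem_Icc.1 hj; omega)) le_rfl
    refine Measurable.ite ?_ mG measurable_const
    exact MeasurableSet.inter (mU (measurableSet_singleton j)) (mZ (measurableSet_singleton v))
  · have hall : ∀ᵐ ω ∂P, ∀ j ∈ Finset.Icc 1 n, X j ω = Z j ω ∧ Z j ω ∈ 𝓢.dirs j :=
      (ae_ball_iff (Finset.Icc 1 n).countable_toSet).2 fun j hj => (hZ j hj).2
    filter_upwards [hall, h.ae_memory_mem hn1, h.ae_choice_mem (show 2 ≤ n + 1 by omega),
      h.step n hn1] with ω h2 h3 h4 h5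
    obtain ⟨h6, h7⟩ := h2 _ h3
    have e : (∑ j ∈ Finset.Icc 1 n, ∑ v ∈ 𝓢.dirs j,
        if U n ω = j ∧ Z j ω = v then G (n + 1) v ω else 0) = G (n + 1) (Z (U n ω) ω) ω := by
      rw [Finset.sum_eq_single_of_mem _ h3, Finset.sum_eq_single_of_mem _ h7, if_pos ⟨rfl, rfl⟩]
      · intro v _ hv; exact if_neg fun hc => hv hc.2.symm
      · intro j _ hj; exact Finset.sum_eq_zero fun v _ => if_neg fun hc => hj hc.1.symm
    rw [e]
    exact ⟨by rw [h5, h6], h4 _ (𝓢.mem_V_of_mem_dirs h7)⟩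

end IsERW
end ERWSetting

/-! ### Conditional law of the next step. -/

namespace ERWSetting
namespace IsERW

variable {d : ℕ} {𝓢 : ERWSetting d}
variable {Ω : Type*} {mΩ : MeasurableSpace Ω} {P : Measure Ω} {p q : ℝ}
  {X : ℕ → Ω → EuclideanSpace ℝ (Fin d)} {U : ℕ → Ω → ℕ}
  {G : ℕ → EuclideanSpace ℝ (Fin d) → Ω → EuclideanSpace ℝ (Fin d)}
  {Z : ℕ → Ω → EuclideanSpace ℝ (Fin d)}

-- Independence is used twice: between the past and the new innovation, then between the memory time
-- and a single choice. No joint law of the choices for different `v` is needed.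
open Classical in
theorem integral_mul_innovation (h : 𝓢.IsERW P p q X U G) {n : ℕ} (hn : 1 ≤ n) {F : Ω → ℂ}
    (hF : Measurable[h.past n] F) {j : ℕ} (hj : j ∈ Finset.Icc 1 n)
    {v w : EuclideanSpace ℝ (Fin d)} (hv : v ∈ 𝓢.V) (hw : w ∈ 𝓢.dirs (n + 1)) :
    ∫ ω, F ω * (if U n ω = j ∧ G (n + 1) v ω = w then (1 : ℂ) else 0) ∂P =
      (∫ ω, F ω ∂P) * ((1 / n * 𝓢.stepProb p q (n + 1) v w : ℝ) : ℂ) := by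
  set A : Set Ω := {ω | U n ω = j ∧ G (n + 1) v ω = w} with hA
  have hAm : MeasurableSet[𝓢.innovation X U G n] A :=
    MeasurableSet.inter (measurable_memory_innovation 𝓢 hn (measurableSet_singleton j))
      (measurable_choice_innovation 𝓢 hn hv (measurableSet_singleton w))
  have hK : Measurable[𝓢.innovation X U G n] (fun ω => if ω ∈ A then (1 : ℂ) else 0) :=
    Measurable.ite hAm measurable_const measurable_const
  have hind : IndepFun F (fun ω => if ω ∈ A then (1 : ℂ) else 0) P := by
    rw [IndepFun_iff_Indep]
    exact indep_of_indep_of_le (h.indep_past_innovation n) hF.comap_le hK.comap_le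
  have hAm' : MeasurableSet A := h.innovation_le n _ hAm
  have hP : P.real A = 1 / n * 𝓢.stepProb p q (n + 1) v w := by
    have h1 := (h.indep_memory_choice n hn v hv).measure_inter_preimage_eq_mul {j} {w}
      (measurableSet_singleton j) (measurableSet_singleton w)
    have h2 : P.real A = P.real {ω | U n ω = j} * P.real {ω | G (n + 1) v ω = w} := by
      rw [measureReal_def, measureReal_def, measureReal_def, ← ENNReal.toReal_mul]
      exact congrArg ENNReal.toReal h1
    rw [h2, h.law_memory n hn j hj, h.law_choice (n + 1) (by omega) v hv w hw]
  have hmul := hind.integral_fun_mul_eq_mul_integral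
    (hF.mono (h.past.le n) le_rfl).aestronglyMeasurable
    (hK.mono (h.innovation_le n) le_rfl).aestronglyMeasurable
  have hint : ∫ ω, (if ω ∈ A then (1 : ℂ) else 0) ∂P = ((P.real A : ℝ) : ℂ) := by
    have : (fun ω => if ω ∈ A then (1 : ℂ) else 0) = A.indicator fun _ => 1 := by
      funext ω; simp [Set.indicator]
    rw [this, integral_indicator hAm', setIntegral_const]
    simp
  rw [← hP, ← hint]
  exact hmul

variable [IsProbabilityMeasure P]

/-- The conditional law of the next step given the past. -/
theorem integral_mul_comp_next (h : 𝓢.IsERW P p q X U G)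
    (hZm : ∀ n ≥ 1, Measurable[h.past n] (Z n)) (hZd : ∀ n ≥ 1, ∀ ω, Z n ω ∈ 𝓢.dirs n)
    (hZX : ∀ n ≥ 1, X n =ᵐ[P] Z n) {n : ℕ} (hn : 1 ≤ n) {H : Ω → ℂ}
    (hH : Measurable[h.past n] H) (hK : ∃ K, ∀ ω, ‖H ω‖ ≤ K)
    (f : EuclideanSpace ℝ (Fin d) → ℝ) :
    ∫ ω, H ω * (f (Z (n + 1) ω) : ℂ) ∂P =
      ∫ ω, H ω * ((1 / n * ∑ j ∈ Finset.Icc 1 n, ∑ w ∈ 𝓢.dirs (n + 1),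
        𝓢.stepProb p q (n + 1) (Z j ω) w * f w : ℝ) : ℂ) ∂P := by
  classical
  obtain ⟨K, hK⟩ := hK
  set F : ℕ → EuclideanSpace ℝ (Fin d) → Ω → ℂ :=
    fun j v ω => H ω * (if Z j ω = v then 1 else 0) with hFdef
  set I : ℕ → EuclideanSpace ℝ (Fin d) → EuclideanSpace ℝ (Fin d) → Ω → ℂ :=
    fun j v w ω => if U n ω = j ∧ G (n + 1) v ω = w then 1 else 0 with hIdef
  have hFm : ∀ j ∈ Finset.Icc 1 n, ∀ v, Measurable[h.past n] (F j v) := by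
    intro j hj v
    have hj' := Finset.mem_Icc.1 hj
    have mZ : Measurable[h.past n] (Z j) :=
      (hZm j hj'.1).mono (h.past.mono hj'.2) le_rfl
    exact hH.mul (Measurable.ite (mZ (measurableSet_singleton v)) measurable_const measurable_const)
  have hFb : ∀ j v ω, ‖F j v ω‖ ≤ K := by
    intro j v ω
    have h0 := (norm_nonneg _).trans (hK ω)
    simp only [hFdef]
    split_ifs
    · simpa using hK ω
    · simpa using h0
  have hFi : ∀ j ∈ Finset.Icc 1 n, ∀ v, Integrable (F j v) P := fun j hj v =>
    integrable_of_measurable_of_norm_le ((hFm j hj v).mono (h.past.le n) le_rfl) K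
      (hFb j v)
  have hIm : ∀ j, ∀ v ∈ 𝓢.V, ∀ w, Measurable (I j v w) := by
    intro j v hv w
    have hU := h.measurable_memory n hn
    have hG := h.measurable_choice (n + 1) (by omega) v hv
    exact Measurable.ite ((hU (measurableSet_singleton j)).inter (hG (measurableSet_singleton w)))
      measurable_const measurable_const
  have hFIi : ∀ j ∈ Finset.Icc 1 n, ∀ v ∈ 𝓢.V, ∀ w,
      Integrable (fun ω => F j v ω * I j v w ω) P := by
    intro j hj v hv w
    refine integrable_of_measurable_of_norm_le
      (((hFm j hj v).mono (h.past.le n) le_rfl).mul (hIm j v hv w)) K fun ω => ?_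
    have h0 := (norm_nonneg _).trans (hK ω)
    simp only [hIdef]
    split_ifs
    · simpa using hFb j v ω
    · simpa using h0
  -- Almost surely exactly one triple of memory time, remembered direction and new direction
  -- contributes, and each summand is a past factor times an innovation factor.
  have lhs : ∫ ω, H ω * (f (Z (n + 1) ω) : ℂ) ∂P = ∫ ω, ∑ j ∈ Finset.Icc 1 n, ∑ v ∈ 𝓢.dirs j,
      ∑ w ∈ 𝓢.dirs (n + 1), F j v ω * I j v w ω * (f w : ℂ) ∂P := by
    refine integral_congr_ae ?_
    have hall : ∀ᵐ ω ∂P, ∀ j ∈ Finset.Icc 1 n, X j ω = Z j ω :=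
      (ae_ball_iff (Finset.Icc 1 n).countable_toSet).2 fun j hj => hZX j (Finset.mem_Icc.1 hj).1
    filter_upwards [hall, h.ae_memory_mem hn, h.step n hn, hZX (n + 1) (by omega)] with ω h1 h2 h3 h4
    have h5 : G (n + 1) (Z (U n ω) ω) ω = Z (n + 1) ω := by
      rw [← h4, h3, h1 _ h2]
    have h6 := hZd (n + 1) (by omega) ω
    rw [Finset.sum_eq_single_of_mem _ h2,
      Finset.sum_eq_single_of_mem _ (hZd (U n ω) (Finset.mem_Icc.1 h2).1 ω),
      Finset.sum_eq_single_of_mem _ h6]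
    · simp [hFdef, hIdef, h5]
    · intro w _ hw
      simp only [hIdef, h5]
      rw [if_neg fun hc => hw hc.2.symm]; simp
    · intro v _ hv
      refine Finset.sum_eq_zero fun w _ => ?_
      simp only [hFdef]
      rw [if_neg fun hc => hv hc.symm]; simp
    · intro j _ hj
      refine Finset.sum_eq_zero fun v _ => Finset.sum_eq_zero fun w _ => ?_
      simp only [hIdef]
      rw [if_neg fun hc => hj hc.1.symm]; simp
  have rhs : ∀ ω, H ω * ((1 / n * ∑ j ∈ Finset.Icc 1 n, ∑ w ∈ 𝓢.dirs (n + 1),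
        𝓢.stepProb p q (n + 1) (Z j ω) w * f w : ℝ) : ℂ) =
      ∑ j ∈ Finset.Icc 1 n, ∑ v ∈ 𝓢.dirs j, ∑ w ∈ 𝓢.dirs (n + 1),
        F j v ω * ((1 / n * 𝓢.stepProb p q (n + 1) v w : ℝ) : ℂ) * (f w : ℂ) := by
    intro ω
    rw [Finset.mul_sum, Complex.ofReal_sum, Finset.mul_sum]
    refine Finset.sum_congr rfl fun j hj => ?_
    rw [Finset.sum_eq_single_of_mem _ (hZd j (Finset.mem_Icc.1 hj).1 ω), Finset.mul_sum,
      Complex.ofReal_sum, Finset.mul_sum]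
    · refine Finset.sum_congr rfl fun w _ => ?_
      simp [hFdef]; ring
    · intro v _ hv
      refine Finset.sum_eq_zero fun w _ => ?_
      simp only [hFdef]
      rw [if_neg fun hc => hv hc.symm]; simp
  have hVj : ∀ {j : ℕ} {v : EuclideanSpace ℝ (Fin d)}, v ∈ 𝓢.dirs j → v ∈ 𝓢.V :=
    fun hv => 𝓢.mem_V_of_mem_dirs hv
  simp_rw [rhs]
  rw [lhs, integral_finsetSum _ fun j hj => integrable_finsetSum _ fun v hv =>
      integrable_finsetSum _ fun w _ => (hFIi j hj v (hVj hv) w).mul_const _,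
    integral_finsetSum _ fun j hj => integrable_finsetSum _ fun v _ =>
      integrable_finsetSum _ fun w _ => ((hFi j hj v).mul_const _).mul_const _]
  refine Finset.sum_congr rfl fun j hj => ?_
  rw [integral_finsetSum _ fun v hv =>
      integrable_finsetSum _ fun w _ => (hFIi j hj v (hVj hv) w).mul_const _,
    integral_finsetSum _ fun v _ =>
      integrable_finsetSum _ fun w _ => ((hFi j hj v).mul_const _).mul_const _]
  refine Finset.sum_congr rfl fun v hv => ?_
  rw [integral_finsetSum _ fun w _ => (hFIi j hj v (hVj hv) w).mul_const _,
    integral_finsetSum _ fun w _ => ((hFi j hj v).mul_const _).mul_const _]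
  refine Finset.sum_congr rfl fun w hw => ?_
  rw [integral_mul_const, integral_mul_const, integral_mul_const,
    h.integral_mul_innovation hn (hFm j hj v) hj (hVj hv) hw]

/-- Centred functions of the reflected steps form an alternating reinforced sequence. -/
theorem altReinforced (h : 𝓢.IsERW P p q X U G)
    (hZm : ∀ n ≥ 1, Measurable[h.past n] (Z n)) (hZd : ∀ n ≥ 1, ∀ ω, Z n ω ∈ 𝓢.dirs n)
    (hZX : ∀ n ≥ 1, X n =ᵐ[P] Z n) {f : EuclideanSpace ℝ (Fin d) → ℝ} (hfm : Measurable f)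
    (hf : ∑ w ∈ 𝓢.Vodd, f w = 0) :
    AltReinforced P h.past (𝓢.γ p q) (𝓢.δ p q) (∑ w ∈ 𝓢.Vodd, |f w|)
      (fun k ω => f ((-1 : ℝ) ^ (k + 1) • Z k ω)) where
  measurable' n hn := hfm.comp ((hZm n hn).const_smul ((-1 : ℝ) ^ (n + 1)))
  bound n hn ω := Finset.single_le_sum (f := fun w => |f w|) (fun w _ => abs_nonneg _)
    (𝓢.sign_smul_mem_Vodd_iff.2 (hZd n hn ω))
  cond n hn H hH hK := by
    have h1 := h.integral_mul_comp_next hZm hZd hZX hn hH hK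
      (fun w => f ((-1 : ℝ) ^ (n + 1 + 1) • w))
    rw [h1]
    refine integral_congr_ae (.of_forall fun ω => ?_)
    dsimp only
    congr 2
    have h2 : ∀ j ∈ Finset.Icc 1 n, ∑ w ∈ 𝓢.dirs (n + 1),
        𝓢.stepProb p q (n + 1) (Z j ω) w * f ((-1 : ℝ) ^ (n + 1 + 1) • w) =
        (𝓢.γ p q + (-1) ^ (n + 1) * (-1) ^ j * 𝓢.δ p q) * f ((-1 : ℝ) ^ (j + 1) • Z j ω) :=
      fun j hj => 𝓢.sum_stepProb_mul_of_sum_eq_zero p q (hZd j (Finset.mem_Icc.1 hj).1 ω) hf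
    -- With `j = k + 1` the two extra signs cancel: $(-1)^{n+1}(-1)^{k+1}=(-1)^n(-1)^k$, the sign in
    -- `altDrift`.
    rw [Finset.sum_congr rfl h2, ← Finset.Ico_succ_right_eq_Icc, Finset.sum_Ico_eq_sum_range]
    simp only [altDrift, stepSum, altSum, Finset.mul_sum, Finset.sum_div,
      Nat.add_sub_cancel, Order.succ_eq_add_one]
    rw [← Finset.sum_add_distrib]
    refine Finset.sum_congr rfl fun k _ => ?_
    rw [add_comm 1 k]
    ring

end IsERW
end ERWSetting

/-! ### From the scalar theorem to the walk. -/

theorem walkPosition_eq_sum {Ω : Type*} {d : ℕ} (X : ℕ → Ω → EuclideanSpace ℝ (Fin d)) (n : ℕ)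
    (ω : Ω) : walkPosition X n ω = ∑ k ∈ Finset.range n, X (k + 1) ω := by
  induction n with
  | zero => rfl
  | succ n ih => rw [Finset.sum_range_succ, ← ih]; rfl

theorem abs_sum_range_neg_one_pow_le (n : ℕ) : |∑ k ∈ Finset.range n, (-1 : ℝ) ^ k| ≤ 1 := by
  have h : ∑ k ∈ Finset.range n, (-1 : ℝ) ^ k = (1 - (-1) ^ n) / 2 := by
    induction n with
    | zero => simp
    | succ n ih => rw [Finset.sum_range_succ, ih, pow_succ]; ring
  rw [h]
  rcases neg_one_pow_eq_or ℝ n with h | h <;> rw [h] <;> norm_num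

namespace ERWSetting

variable {d : ℕ} (𝓢 : ERWSetting d)

theorem posSemidef_limitCov {p q : ℝ} (hδ : 𝓢.δ p q < 1 / 2) : (𝓢.limitCov p q).PosSemidef := by
  have hm := 𝓢.two_le_m
  refine Matrix.PosSemidef.smul (Matrix.posSemidef_sum _ fun v _ => ?_) ?_
  · simpa using Matrix.posSemidef_vecMulVec_self_star (⇑(v - 𝓢.vbar))
  · have : 0 < 1 - 2 * 𝓢.δ p q := by linarith
    positivity

theorem dotProduct_limitCov_mulVec (p q : ℝ) (t : EuclideanSpace ℝ (Fin d)) :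
    ⇑t ⬝ᵥ (𝓢.limitCov p q).mulVec ⇑t =
      1 / ((𝓢.m : ℝ) * (1 - 2 * 𝓢.δ p q)) * ∑ v ∈ 𝓢.Vodd, (inner ℝ t (v - 𝓢.vbar)) ^ 2 := by
  rw [limitCov, Matrix.smul_mulVec, dotProduct_smul, Matrix.sum_mulVec, dotProduct_sum,
    smul_eq_mul]
  congr 1
  refine Finset.sum_congr rfl fun v _ => ?_
  rw [Matrix.vecMulVec_mulVec, dotProduct_smul, EuclideanSpace.inner_eq_star_dotProduct]
  simp only [star_trivial, MulOpposite.smul_eq_mul_unop, MulOpposite.unop_op]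
  rw [dotProduct_comm]; ring

theorem sum_inner_sub_vbar (t : EuclideanSpace ℝ (Fin d)) :
    ∑ v ∈ 𝓢.Vodd, inner ℝ t (v - 𝓢.vbar) = 0 := by
  have hm := 𝓢.two_le_m
  rw [← inner_sum, Finset.sum_sub_distrib, Finset.sum_const, vbar, ← Nat.cast_smul_eq_nsmul ℝ,
    smul_smul]
  change inner ℝ t (_ - ((𝓢.m : ℝ) * (1 / 𝓢.m)) • _) = 0
  rw [mul_one_div_cancel (by linarith), one_smul, sub_self, inner_zero_right]

variable {Ω : Type*} {mΩ : MeasurableSpace Ω} {P : Measure Ω} {p q : ℝ}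
  {X : ℕ → Ω → EuclideanSpace ℝ (Fin d)} {U : ℕ → Ω → ℕ}
  {G : ℕ → EuclideanSpace ℝ (Fin d) → Ω → EuclideanSpace ℝ (Fin d)}
  {Z : ℕ → Ω → EuclideanSpace ℝ (Fin d)} [IsProbabilityMeasure P]

namespace IsERW
variable {𝓢}

-- After the sign flip `δ` governs the growth of the sum, hence the condition `δ < 1 / 2` and the
-- factor `1 - 2 * δ` in the variance. Squares are insensitive to the flip, so the centred squares
-- keep the parameters `γ`, `δ` and need only the law of large numbers.
open Topology in
theorem tendsto_integral_cexp_altSum (h : 𝓢.IsERW P p q X U G)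
    (hZm : ∀ n ≥ 1, Measurable[h.past n] (Z n)) (hZd : ∀ n ≥ 1, ∀ ω, Z n ω ∈ 𝓢.dirs n)
    (hZX : ∀ n ≥ 1, X n =ᵐ[P] Z n) (hγ : 𝓢.γ p q < 1) (hδ : 𝓢.δ p q < 1 / 2)
    {f : EuclideanSpace ℝ (Fin d) → ℝ} (hfm : Measurable f) (hf : ∑ w ∈ 𝓢.Vodd, f w = 0) :
    Tendsto (fun n : ℕ => ∫ ω, Complex.exp (Complex.I *
      ((altSum (fun k ω => f ((-1 : ℝ) ^ (k + 1) • Z k ω)) n ω / √(n : ℝ) : ℝ) : ℂ)) ∂P) atTop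
      (𝓝 ((Real.exp (-(1 / ((𝓢.m : ℝ) * (1 - 2 * 𝓢.δ p q)) * (∑ w ∈ 𝓢.Vodd, f w ^ 2) / 2) : ℝ)
        : ℝ) : ℂ)) := by
  have hm := 𝓢.two_le_m
  set s₀ := 1 / (𝓢.m : ℝ) * ∑ w ∈ 𝓢.Vodd, f w ^ 2 with hs₀
  have hs : 0 ≤ s₀ := mul_nonneg (by positivity) (Finset.sum_nonneg fun w _ => sq_nonneg _)
  have hsum : ∑ w ∈ 𝓢.Vodd, (f w ^ 2 - s₀) = 0 := by
    rw [Finset.sum_sub_distrib, Finset.sum_const, nsmul_eq_mul, hs₀]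
    change _ - (𝓢.m : ℝ) * _ = 0
    field_simp
    simp
  have hx := (h.altReinforced hZm hZd hZX hfm hf).signFlip
  have hz := h.altReinforced hZm hZd hZX ((hfm.pow_const 2).sub_const s₀) hsum
  have e : (fun k ω => signFlip (fun k ω => f ((-1 : ℝ) ^ (k + 1) • Z k ω)) k ω ^ 2 - s₀) =
      fun k ω => f ((-1 : ℝ) ^ (k + 1) • Z k ω) ^ 2 - s₀ := by
    funext k ω
    rw [signFlip, mul_pow, ← pow_mul, mul_comm (k + 1) 2, pow_mul]
    simp
  have main := hx.tendsto_integral_cexp_stepSum (s₀ := s₀) (e ▸ hz) hs hδ hγ hγ (by linarith)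
  rw [stepSum_signFlip] at main
  convert main using 5
  have : 1 - 2 * 𝓢.δ p q ≠ 0 := by linarith
  rw [hs₀]
  field_simp

end IsERW
end ERWSetting

theorem mainTheorem1 {d : ℕ} (𝓢 : ERWSetting d) {Ω : Type*} [MeasurableSpace Ω]
    (P : Measure Ω) [IsProbabilityMeasure P]
    (p q : ℝ) (hp : p ∈ Set.Icc (0 : ℝ) 1) (hq : q ∈ Set.Icc (0 : ℝ) 1)
    (X : ℕ → Ω → EuclideanSpace ℝ (Fin d)) (U : ℕ → Ω → ℕ)
    (G : ℕ → EuclideanSpace ℝ (Fin d) → Ω → EuclideanSpace ℝ (Fin d))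
    (hX : 𝓢.IsERW P p q X U G)
    (hγ : 𝓢.γ p q < 1) (hδ : 𝓢.δ p q < 1 / 2) :
    (𝓢.limitCov p q).PosSemidef ∧
    TendstoInDistribution (fun (n : ℕ) (ω : Ω) => (1 / √(n : ℝ)) • walkPosition X n ω) atTop
      (id : EuclideanSpace ℝ (Fin d) → EuclideanSpace ℝ (Fin d)) (fun _ => P)
      (multivariateGaussian 0 (𝓢.limitCov p q)) := by
  have hpsd := 𝓢.posSemidef_limitCov (p := p) (q := q) hδ
  have hmod : ∀ n, ∃ Z : Ω → EuclideanSpace ℝ (Fin d), 1 ≤ n →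
      Measurable[hX.past n] Z ∧ (∀ ω, Z ω ∈ 𝓢.dirs n) ∧ X n =ᵐ[P] Z := by
    intro n
    by_cases hn : 1 ≤ n
    · obtain ⟨Z, hZ⟩ := hX.exists_adapted_modification n hn
      exact ⟨Z, fun _ => hZ⟩
    · exact ⟨X 0, fun hn' => absurd hn' hn⟩
  choose Z hZ using hmod
  have hZm := fun n (hn : n ≥ 1) => (hZ n hn).1
  have hZd := fun n (hn : n ≥ 1) => (hZ n hn).2.1
  have hZX := fun n (hn : n ≥ 1) => (hZ n hn).2.2
  have hZmeas : ∀ n ≥ 1, Measurable (Z n) := fun n hn => (hZm n hn).mono (hX.past.le n) le_rfl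
  have hWm : ∀ n : ℕ, Measurable fun ω => (1 / √(n : ℝ)) • ∑ k ∈ Finset.range n, Z (k + 1) ω :=
    fun n => (Finset.measurable_fun_sum _ fun k _ => hZmeas (k + 1) (by omega)).const_smul
      (1 / √(n : ℝ))
  have hWX : ∀ n : ℕ, (fun ω => (1 / √(n : ℝ)) • walkPosition X n ω) =ᵐ[P]
      fun ω => (1 / √(n : ℝ)) • ∑ k ∈ Finset.range n, Z (k + 1) ω := by
    intro n
    have hall : ∀ᵐ ω ∂P, ∀ k ∈ Finset.range n, X (k + 1) ω = Z (k + 1) ω :=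
      (ae_ball_iff (Finset.range n).countable_toSet).2 fun k _ => hZX (k + 1) (by omega)
    filter_upwards [hall] with ω hω
    rw [walkPosition_eq_sum, Finset.sum_congr rfl hω]
  refine ⟨hpsd, fun n => (hWm n).aemeasurable.congr (hWX n).symm, aemeasurable_id, ?_⟩
  -- By Lévy's continuity theorem each `t` is treated separately, with `t` built into the centred
  -- function `f`.
  refine ProbabilityMeasure.tendsto_iff_tendsto_charFun.2 fun t => ?_
  simp only [ProbabilityMeasure.coe_mk, Measure.map_id]
  set f : EuclideanSpace ℝ (Fin d) → ℝ := fun v => inner ℝ t (v - 𝓢.vbar) with hfdef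
  have hfm : Measurable f := by fun_prop
  have main := hX.tendsto_integral_cexp_altSum hZm hZd hZX hγ hδ hfm (𝓢.sum_inner_sub_vbar t)
  have hlim : charFun (multivariateGaussian 0 (𝓢.limitCov p q)) t =
      ((Real.exp (-(1 / ((𝓢.m : ℝ) * (1 - 2 * 𝓢.δ p q)) * (∑ w ∈ 𝓢.Vodd, f w ^ 2) / 2)) : ℝ)
        : ℂ) := by
    rw [charFun_multivariateGaussian hpsd, 𝓢.dotProduct_limitCov_mulVec, inner_zero_right]
    push_cast
    congr 1
    ring
  rw [hlim]
  refine (tendsto_iff_of_dist ?_).1 main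
  have hsq : Tendsto (fun n : ℕ => √(n : ℝ)) atTop atTop :=
    Real.tendsto_sqrt_atTop.comp tendsto_natCast_atTop_atTop
  refine squeeze_zero (fun n => dist_nonneg) (fun n => ?_)
    (hsq.const_div_atTop |inner ℝ t 𝓢.vbar|)
  rw [Measure.map_congr (hWX n), charFun_apply,
    integral_map (hWm n).aemeasurable (by fun_prop), dist_eq_norm]
  have hA := (hX.altReinforced hZm hZd hZX hfm (𝓢.sum_inner_sub_vbar t)).measurable_altSum n
  have hI : Measurable fun ω =>
      (inner ℝ ((1 / √(n : ℝ)) • ∑ k ∈ Finset.range n, Z (k + 1) ω) t : ℝ) :=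
    (hWm n).inner_const
  have hdiff := AltReinforced.norm_integral_cexp_I_mul_sub_le (P := P)
    (hA.div_const √(n : ℝ)) hI (K := |inner ℝ t 𝓢.vbar| / √(n : ℝ)) fun ω => ?_
  · simp_rw [mul_comm Complex.I] at hdiff ⊢
    exact hdiff
  -- The alternating sign undoes the reflection of the step, while the subtracted means alternate
  -- and sum to at most one copy of `inner ℝ t 𝓢.vbar` in absolute value. The difference vanishes
  -- after division by `√n`.
  · have e : altSum (fun k ω => f ((-1 : ℝ) ^ (k + 1) • Z k ω)) n ω =
        inner ℝ t (∑ k ∈ Finset.range n, Z (k + 1) ω) -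
          (∑ k ∈ Finset.range n, (-1 : ℝ) ^ k) * inner ℝ t 𝓢.vbar := by
      rw [altSum, inner_sum, Finset.sum_mul, ← Finset.sum_sub_distrib]
      refine Finset.sum_congr rfl fun k _ => ?_
      simp only [hfdef, inner_sub_right, inner_smul_right, pow_succ]
      rcases neg_one_pow_eq_or ℝ k with h | h <;> rw [h] <;> ring
    rw [e, real_inner_comm, real_inner_smul_left]
    have e2 : ∀ a b c : ℝ, (a - b * c) / √(n : ℝ) - 1 / √(n : ℝ) * a = -(b * c / √(n : ℝ)) := by
      intro a b c; ring
    rw [e2, abs_neg, abs_div, abs_mul, abs_of_nonneg (Real.sqrt_nonneg _)]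
    gcongr
    exact mul_le_of_le_one_left (abs_nonneg _) (abs_sum_range_neg_one_pow_le n)
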